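/- Setting. Let $\mathcal X$ be a measurable space and let $\mathcal F$ be a class of measurable hypotheses $f:\mathcal X\to\{0,1\}$ of (finite) VC dimension $d$. There are $k\ge 2$ players with arbitrary probability distributions $D_1,\dots,D_k$ on $\mathcal X\times\{0,1\}$. Put $\mathrm{err}_D(f)=\Pr_{(x,y)\sim D}[f(x)\ne y]$, let $\mathrm{err}_S(f)$ be the fraction of examples of a finite sample $S$ that $f$ mislabels, and let $\mathrm{OPT}=\inf_{f\in\mathcal F}\max_{i\in[k]}\mathrm{err}_{D_i}(f)$ (which need not be $0$). Let $\epsilon,\delta\in(0,1)$ and $7\epsilon/6<\alpha<1$, and set $$\alpha'=\alpha/35,\qquad \epsilon'=\epsilon/60,\qquad t=2\lceil \ln(k)/\alpha'^3\rceil,\qquad \delta'=\delta/(4t).$$ Let $\mathcal O_{\mathcal F}$ be an empirical risk minimizer: it maps every labelled sample $S$ to some $\mathcal O_{\mathcal F}(S)\in\mathcal F$ with $\mathrm{err}_S(\mathcal O_{\mathcal F}(S))\le\inf_{f\in\mathcal F}\mathrm{err}_S(f)+\epsilon'$, and $(S,x)\mapsto\mathcal O_{\mathcal F}(S)(x)$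 is measurable. Algorithm NR1 with sample sizes $n_S,n_T$: start with $w_i^{(0)}=1$ for all $i\in[k]$. In round $r=1,\dots,t$, draw a sample $S^{(r)}$ of $n_S$ independent examples from the mixture $\tilde D^{(r-1)}=\frac1{\Phi^{(r-1)}}\sum_{i=1}^k w_i^{(r-1)}D_i$, where $\Phi^{(r-1)}=\sum_{i=1}^k w_i^{(r-1)}$; let $f^{(r)}=\mathcal O_{\mathcal F}(S^{(r)})$; for each player $i$ draw a fresh sample $T_i$ of $n_T$ independent examples from $D_i$; and update $$w_i^{(r)}=w_i^{(r-1)}\bigl(1+s_i^{(r)}\bigr),\qquad s_i^{(r)}=\min\left(\frac{\mathrm{err}_{T_i}(f^{(r)})\,\alpha'^2}{(1+3\alpha')\,\mathrm{err}_{S^{(r)}}(f^{(r)})+3\epsilon'},\ \alpha'\right).$$ Return the majority vote $f_{\mathrm{NR1}}=\mathrm{maj}(f^{(1)},\dots,f^{(t)})$, where a tie is resolved as the label $0$. Theorem 3. There are a universal constant $C>0$ and sample sizes $n_S,n_T$, depending only on $d,k,\epsilon,\delta,\alpha$, with $$n_S\le \frac{C}{\alpha'\epsilon'}\Bigl(d\ln\frac1{\epsilon'}+\ln\frac1{\delta'}\Bigr),\qquad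 n_T\le\frac{C}{\alpha'\epsilon'}\ln\frac{k}{\delta'},$$ such that, for all $\mathcal X$, $\mathcal F$, $\mathcal O_{\mathcal F}$ and $D_1,\dots,D_k$ as above, with probability at least $1-\delta$ the classifier returned by Algorithm NR1 satisfies $$\mathrm{err}_{D_i}(f_{\mathrm{NR1}})\le(2+\alpha)\,\mathrm{OPT}+\epsilon\qquad\text{for all } i\in[k],$$ and the total number $m=t\,(n_S+k\,n_T)$ of examples drawn satisfies $$m\le C\cdot\frac{\ln k}{\alpha^4\epsilon}\Bigl(d\ln\frac1\epsilon+k\ln\frac k\delta\Bigr).$$ -/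

import Mathlib

open MeasureTheory

namespace CollabPAC

noncomputable section

/-! ### Hypothesis classes, errors, VC dimension -/

/-- A hypothesis class `F` shatters the finite set `A` if every labelling of `A` is realized by some
member of `F`. -/
def Shatters {X : Type*} (F : Set (X → Bool)) (A : Finset X) : Prop :=
  ∀ g : X → Bool, ∃ f ∈ F, ∀ x ∈ A, f x = g x

/-- `F` has VC dimension exactly `d` (so the dimension is finite, and `F` is non-empty). -/
def HasVCDim {X : Type*} (F : Set (X → Bool)) (d : ℕ) : Prop :=
  (∃ A : Finset X, A.card = d ∧ Shatters F A) ∧ ∀ A : Finset X, Shatters F A → A.card ≤ d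

/-- The error `Pr_{(x,y) ∼ D} [f x ≠ y]`. -/
def err {X : Type*} [MeasurableSpace X] (D : Measure (X × Bool)) (f : X → Bool) : ℝ :=
  D.real {p | f p.1 ≠ p.2}

/-- The error of `f` on a sample of size `n`: the fraction of mislabelled examples. -/
def empErr {X : Type*} {n : ℕ} (S : Fin n → X × Bool) (f : X → Bool) : ℝ :=
  ((Finset.univ.filter fun j => f (S j).1 ≠ (S j).2).card : ℝ) / n

/-- `OPT = inf_{f ∈ F} max_i err_{D_i}(f)`. -/
def OPT {X : Type*} [MeasurableSpace X] {k : ℕ} (F : Set (X → Bool))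
    (D : Fin k → Measure (X × Bool)) : ℝ :=
  ⨅ f : F, ⨆ i : Fin k, err (D i) f.1

/-- A learning rule: a map that takes a labelled sample (of any size) to a classifier. -/
abbrev LearningRule (X : Type*) : Type _ := (n : ℕ) → (Fin n → X × Bool) → X → Bool

/-- `O` is an empirical risk minimizer for `F`, up to the additive tolerance `τ`. -/
def IsERM {X : Type*} (F : Set (X → Bool)) (τ : ℝ) (O : LearningRule X) : Prop :=
  ∀ (n : ℕ) (S : Fin n → X × Bool),
    O n S ∈ F ∧ empErr S (O n S) ≤ (⨅ f : F, empErr S f.1) + τ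

/-- The label that the learning rule gives to a point depends measurably on sample and point. -/
def IsMeasurableRule {X : Type*} [MeasurableSpace X] (O : LearningRule X) : Prop :=
  ∀ n : ℕ, Measurable fun p : (Fin n → X × Bool) × X => O n p.1 p.2

/-- The majority vote of `t` classifiers (a tie is resolved in favour of the label `false`). -/
def maj {X : Type*} {t : ℕ} (f : Fin t → X → Bool) (x : X) : Bool :=
  decide (t < 2 * (Finset.univ.filter fun r => f r x = true).card)

/-! ### The parameters of the algorithm -/

/-- `α' = α / 35`. -/
def aPar (α : ℝ) : ℝ := α / 35

/-- `ε' = ε / 60`. -/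
def ePar (ε : ℝ) : ℝ := ε / 60

/-- The number of rounds `t = 2 ⌈ln k / α'³⌉`. -/
def rounds (k : ℕ) (α : ℝ) : ℕ := 2 * ⌈Real.log k / aPar α ^ 3⌉₊

/-- `δ' = δ / (4t)`. -/
def dPar (k : ℕ) (α δ : ℝ) : ℝ := δ / (4 * rounds k α)

/-! ### One round and the run of the algorithm -/

/-- The examples drawn in one round: the sample `S` of size `nS` from the mixture, and for every
player `i` the sample `T i` of size `nT`. -/
abbrev RoundData (X : Type*) (k nS nT : ℕ) : Type _ :=
  (Fin nS → X × Bool) × (Fin k → Fin nT → X × Bool)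

/-- The increment `s_i` of player `i` in a round with data `(S, T)`, where `f = O(S)`:
`min (err_{T_i}(f) α'² / ((1 + 3α') err_S(f) + 3ε')) α'`. -/
def score {X : Type*} {k nS nT : ℕ} (O : LearningRule X) (α ε : ℝ)
    (R : RoundData X k nS nT) (i : Fin k) : ℝ :=
  min (empErr (R.2 i) (O nS R.1) * aPar α ^ 2 /
      ((1 + 3 * aPar α) * empErr R.1 (O nS R.1) + 3 * ePar ε))
    (aPar α)

/-- The weights `w_i^{(r)}` after `r` rounds with data `h`: `w_i^{(0)} = 1` and
`w_i^{(r+1)} = w_i^{(r)} (1 + s_i^{(r+1)})`. -/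
def weight {X : Type*} {k nS nT : ℕ} (O : LearningRule X) (α ε : ℝ) :
    (r : ℕ) → (Fin r → RoundData X k nS nT) → Fin k → ℝ
  | 0, _, _ => 1
  | r + 1, h, i =>
      weight O α ε r (fun j => h j.castSucc) i * (1 + score O α ε (h (Fin.last r)) i)

/-- The mixture `(1/Φ) ∑ i, w_i D_i` with `Φ = ∑ i, w_i`. -/
def mixture {X : Type*} [MeasurableSpace X] {k : ℕ} (w : Fin k → ℝ)
    (D : Fin k → Measure (X × Bool)) : Measure (X × Bool) :=
  ∑ i, ENNReal.ofReal (w i / ∑ j, w j) • D i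

/-- The law of the data of a round that starts with weights `w`: `nS` independent examples from the
mixture, and independently of them, for each player `i`, `nT` independent examples from `D i`. -/
def roundLaw {X : Type*} [MeasurableSpace X] {k : ℕ} (nS nT : ℕ)
    (D : Fin k → Measure (X × Bool)) (w : Fin k → ℝ) : Measure (RoundData X k nS nT) :=
  (Measure.pi fun _ : Fin nS => mixture w D).prod
    (Measure.pi fun i : Fin k => Measure.pi fun _ : Fin nT => D i)

/-- The law of the data of the first `r` rounds: given the data `h` of the earlier rounds, the next
round is drawn from `roundLaw` with the current weights. -/
def runLaw {X : Type*} [MeasurableSpace X] {k : ℕ} (nS nT : ℕ) (O : LearningRule X) (α ε : ℝ)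
    (D : Fin k → Measure (X × Bool)) : (r : ℕ) → Measure (Fin r → RoundData X k nS nT)
  | 0 => Measure.dirac Fin.elim0
  | r + 1 => (runLaw nS nT O α ε D r).bind fun h =>
      (roundLaw nS nT D (weight O α ε r h)).map fun R =>
        (Fin.snoc (α := fun _ => RoundData X k nS nT) h R : Fin (r + 1) → RoundData X k nS nT)

/-- The classifier returned by the algorithm when `h` is the data of all rounds: the majority vote of
the classifiers `f^{(r)} = O(S^{(r)})`. -/
def output {X : Type*} {k nS nT t : ℕ} (O : LearningRule X)
    (h : Fin t → RoundData X k nS nT) : X → Bool :=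
  maj fun r => O nS (h r).1

/-- The number of examples that the algorithm draws: `nS + k * nT` in each round. -/
def sampleCount (k nS nT : ℕ) (α : ℝ) : ℕ := rounds k α * (nS + k * nT)

end

end CollabPAC

/-!
The increment of a player is normalized by the empirical error on the mixture, and the error on the
mixture is the weighted average of the errors of the players. As long as the samples are
representative, the total weight therefore grows by a factor of about `1 + α'²` in a round, while
the weight of a single player, the exponential of the sum of its increments up to lower order, is at
most the total weight. Comparing logarithms, the sum over the `t` rounds of
`min (err_{D_i}(f^{(r)}) α'² / Q) α'`, where `Q = (1 + O(α')) OPT + O(ε')`, is at most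
`(1 + O(α')) α'² t`; the choice of `t` makes `ln k` a lower order term. A point that the majority
vote mislabels is mislabelled in at least half of the rounds, so this sum controls the error of the
vote by `2 (1 + O(α')) Q`.

The sample from the mixture has to be representative in every round and for all of `F`: this is a
relative deviation bound, proved by symmetrization and the Sauer-Shelah lemma. The samples from the
players may be smaller, since only the deviations accumulated over all rounds matter. Conditionally
on the past, the deviation of a round has exponential moment at most one, so these moments multiply
along the run, and Markov's inequality bounds the accumulated deviation. If the VC dimension is `0`,
then `F` is a single hypothesis and no examples are needed.
-/

namespace CollabPAC

open Real (exp log)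
open ENNReal (ofReal)
open Finset (univ)

section ExpMoment

variable {Ω : Type*} [MeasurableSpace Ω] {μ : Measure Ω} {f g : Ω → ℝ}

/-- The exponential moment `E[exp f]`, the common currency of all the tail bounds below. It takes
values in `[0, ∞]`, so that no integrability has to be presupposed. -/
noncomputable def expMoment (μ : Measure Ω) (f : Ω → ℝ) : ENNReal :=
  ∫⁻ ω, ofReal (exp (f ω)) ∂μ

lemma expMoment_mono (h : ∀ ω, f ω ≤ g ω) : expMoment μ f ≤ expMoment μ g :=
  lintegral_mono fun ω => ENNReal.ofReal_le_ofReal (Real.exp_le_exp.2 (h ω))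

lemma expMoment_const_add (c : ℝ) (f : Ω → ℝ) :
    expMoment μ (fun ω => c + f ω) = ofReal (exp c) * expMoment μ f := by
  simp only [expMoment, Real.exp_add, ENNReal.ofReal_mul (Real.exp_pos c).le]
  exact lintegral_const_mul' _ _ ENNReal.ofReal_ne_top

lemma measure_lt_le_exp_mul_expMoment (hf : Measurable f) (u : ℝ) :
    μ {ω | u < f ω} ≤ ofReal (exp (-u)) * expMoment μ f := by
  rw [← expMoment_const_add, ← lintegral_indicator_one (measurableSet_lt measurable_const hf)]
  refine lintegral_mono (Set.indicator_le fun ω (hω : u < f ω) => ?_)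
  rw [Pi.one_apply, ENNReal.one_le_ofReal, Real.one_le_exp_iff]
  linarith

lemma expMoment_sum_mul_le {ι : Type*} [Fintype ι] {p : ι → ℝ} {g : ι → Ω → ℝ} {M : ENNReal}
    (hp : ∀ i, 0 ≤ p i) (hp1 : ∑ i, p i = 1) (hg : ∀ i, Measurable (g i))
    (hM : ∀ i, expMoment μ (g i) ≤ M) :
    expMoment μ (fun ω => ∑ i, p i * g i ω) ≤ M := by
  have jensen : ∀ ω, ofReal (exp (∑ i, p i * g i ω)) ≤
      ∑ i, ofReal (p i) * ofReal (exp (g i ω)) := by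
    intro ω
    simp only [← ENNReal.ofReal_mul (hp _)]
    rw [← ENNReal.ofReal_sum_of_nonneg fun i _ => mul_nonneg (hp i) (Real.exp_pos _).le]
    exact ENNReal.ofReal_le_ofReal
      (convexOn_exp.map_sum_le (fun i _ => hp i) hp1 fun i _ => Set.mem_univ (g i ω))
  calc expMoment μ (fun ω => ∑ i, p i * g i ω)
      ≤ ∫⁻ ω, ∑ i, ofReal (p i) * ofReal (exp (g i ω)) ∂μ := lintegral_mono jensen
    _ = ∑ i, ofReal (p i) * expMoment μ (g i) := by
        rw [lintegral_finsetSum _ fun i _ => by fun_prop]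
        exact Finset.sum_congr rfl fun i _ => lintegral_const_mul' _ _ ENNReal.ofReal_ne_top
    _ ≤ ∑ i, ofReal (p i) * M := by gcongr with i; exact hM i
    _ = M := by
        rw [← Finset.sum_mul, ← ENNReal.ofReal_sum_of_nonneg fun i _ => hp i, hp1,
          ENNReal.ofReal_one, one_mul]

lemma expMoment_comp_measurePreserving {Ω' : Type*} [MeasurableSpace Ω'] {ν : Measure Ω'}
    {φ : Ω → Ω'} (hφ : MeasurePreserving φ μ ν) {g : Ω' → ℝ} (hg : Measurable g) :
    expMoment μ (fun ω => g (φ ω)) = expMoment ν g :=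
  hφ.lintegral_comp (f := fun ω => ofReal (exp (g ω))) (by fun_prop)

end ExpMoment

section ExpInequalities

variable {a l m x θ : ℝ}

lemma exp_sub_one_le_mul (h0 : 0 ≤ θ) (h : θ ≤ a) (ha : a ≤ 1) : exp θ - 1 ≤ θ * (1 + a) := by
  have h1 := (abs_le.1 (Real.abs_exp_sub_one_sub_id_le (abs_le.2 ⟨by linarith, h.trans ha⟩))).2
  nlinarith

lemma exp_neg_sub_one_le_neg_mul (h0 : 0 ≤ θ) (h : θ ≤ a) (ha : a ≤ 1) :
    exp (-θ) - 1 ≤ -(θ * (1 - a)) := by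
  have h1 := (abs_le.1 (Real.abs_exp_sub_one_sub_id_le (x := -θ)
    (abs_le.2 ⟨by linarith, by linarith⟩))).2
  nlinarith

lemma exp_neg_half_mul_le (ha : 0 < a) (ha1 : a ≤ 1 / 35) (hl : 1 ≤ l * a ^ 2) :
    exp (-(l * a / 2)) ≤ l * a ^ 3 := by
  have hl0 : 0 < l := pos_of_mul_pos_left (zero_lt_one.trans_le hl) (sq_nonneg a)
  have hquad := Real.quadratic_le_exp_of_nonneg (x := l * a / 2) (by positivity)
  have hcube : 1 ≤ (l * a ^ 2) ^ 3 := one_le_pow₀ hl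
  rw [Real.exp_neg, inv_le_iff_one_le_mul₀ (Real.exp_pos _)]
  calc 1 ≤ (l * a ^ 2) ^ 3 * (1 / a) / 8 := by
        have : 35 ≤ 1 / a := by rw [le_div_iff₀ ha]; linarith
        nlinarith
    _ = l * a ^ 3 * ((l * a / 2) ^ 2 / 2) := by field_simp; norm_num
    _ ≤ l * a ^ 3 * exp (l * a / 2) := by gcongr; nlinarith [mul_pos hl0 ha]

lemma one_add_exp_neg_le (ha : 0 < a) (ha1 : a ≤ 1 / 35) (hl : 1 ≤ l * a ^ 2) (hm0 : 0 ≤ m)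
    (hma : m ≤ a) : 1 + exp (-(l * (a - m))) ≤ exp (l * (7 / 5 * a * m + a ^ 3)) := by
  have hl0 : 0 < l := pos_of_mul_pos_left (zero_lt_one.trans_le hl) (sq_nonneg a)
  have hla3 : 0 ≤ l * a ^ 3 := by positivity
  have hlam : 0 ≤ l * a * m := by positivity
  rcases le_or_gt (a / 2) m with h | h
  · have htwo : (2 : ℝ) ≤ exp (7 / 10) := by
      rw [← Real.log_le_iff_le_exp (by norm_num)]
      linarith [Real.log_two_lt_d9]
    have hle1 : exp (-(l * (a - m))) ≤ 1 :=
      Real.exp_le_one_iff.2 (by nlinarith)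
    have hlam' : l * a * (a / 2) ≤ l * a * m := by gcongr
    calc 1 + exp (-(l * (a - m))) ≤ exp (7 / 10) := by linarith
      _ ≤ _ := Real.exp_le_exp.2 (by linarith)
  · have hexp : exp (-(l * (a - m))) ≤ exp (-(l * a / 2)) := Real.exp_le_exp.2 (by nlinarith)
    linarith [exp_neg_half_mul_le ha ha1 hl, Real.add_one_le_exp (l * (7 / 5 * a * m + a ^ 3))]

lemma exp_neg_add_exp_neg_le (ha : 0 < a) (ha1 : a ≤ 1 / 35) (hl : 1 ≤ l * a ^ 2) (hx : 0 ≤ x) :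
    exp (-(l * x * (1 - a))) + exp (-(l * a)) ≤
      exp (-(l * ((1 - 12 / 5 * a) * min x a - a ^ 3))) := by
  have hl0 : 0 < l := pos_of_mul_pos_left (zero_lt_one.trans_le hl) (sq_nonneg a)
  set m := min x a
  have hm0 : 0 ≤ m := le_min hx ha.le
  have hmx : exp (-(l * x * (1 - a))) ≤ exp (-(l * m * (1 - a))) := by
    have : l * m * (1 - a) ≤ l * x * (1 - a) := by
      gcongr
      · linarith
      · exact min_le_left _ _
    exact Real.exp_le_exp.2 (neg_le_neg this)
  have hla : exp (-(l * a)) ≤ exp (-(l * m * (1 - a))) * exp (-(l * (a - m))) := by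
    rw [← Real.exp_add]
    exact Real.exp_le_exp.2 (by nlinarith [mul_nonneg (mul_nonneg hl0.le hm0) ha.le])
  calc _ ≤ exp (-(l * m * (1 - a))) * (1 + exp (-(l * (a - m)))) := by linarith
    _ ≤ exp (-(l * m * (1 - a))) * exp (l * (7 / 5 * a * m + a ^ 3)) := by
        gcongr; exact one_add_exp_neg_le ha ha1 hl hm0 (min_le_right _ _)
    _ = _ := by rw [← Real.exp_add]; ring_nf

end ExpInequalities

section Hits

variable {Z : Type*} {n : ℕ} {E : Set Z}

/-- The number of points of the sample `S` that lie in `E`. -/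
noncomputable def hits (S : Fin n → Z) (E : Set Z) : ℝ := ∑ j, E.indicator 1 (S j)

lemma exp_mul_hits (θ : ℝ) (S : Fin n → Z) (E : Set Z) :
    exp (θ * hits S E) = ∏ j, exp (θ * E.indicator 1 (S j)) := by
  rw [hits, Finset.mul_sum, Real.exp_sum]

lemma exp_mul_indicator_one (θ : ℝ) (E : Set Z) (z : Z) :
    exp (θ * E.indicator 1 z) = 1 + E.indicator (fun _ => exp θ - 1) z := by
  by_cases hz : z ∈ E <;> simp [hz]

variable [MeasurableSpace Z]

@[fun_prop]
lemma measurable_hits (hE : MeasurableSet E) : Measurable fun S : Fin n → Z => hits S E :=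
  Finset.measurable_sum _ fun j _ => (measurable_one.indicator hE).comp (measurable_pi_apply j)

variable (μ : Measure Z) [IsProbabilityMeasure μ] (hE : MeasurableSet E)
include hE

lemma expMoment_mul_hits (n : ℕ) (θ : ℝ) :
    expMoment (Measure.pi fun _ : Fin n => μ) (fun S => θ * hits S E) =
      ofReal ((1 + μ.real E * (exp θ - 1)) ^ n) := by
  have hind : Integrable (E.indicator fun _ : Z => exp θ - 1) μ :=
    (integrable_const _).indicator hE
  have hint : Integrable (fun z => exp (θ * E.indicator 1 z)) μ := by
    simp only [exp_mul_indicator_one]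
    exact (integrable_const _).add hind
  have hmgf : ∫ z, exp (θ * E.indicator 1 z) ∂μ = 1 + μ.real E * (exp θ - 1) := by
    simp only [exp_mul_indicator_one]
    rw [integral_add (integrable_const _) hind, integral_indicator_const _ hE]
    simp
  simp only [expMoment, exp_mul_hits]
  rw [← ofReal_integral_eq_lintegral_ofReal (Integrable.fintype_prod fun _ => hint)
      (.of_forall fun S => Finset.prod_nonneg fun j _ => (Real.exp_pos _).le),
    integral_fintype_prod_eq_prod (𝕜 := ℝ) (μ := fun _ => μ) fun _ z => exp (θ * E.indicator 1 z),
    hmgf, Finset.prod_const, Finset.card_univ, Fintype.card_fin]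

lemma exp_mul_le_expMoment_mul_hits (n : ℕ) (θ : ℝ) :
    ofReal (exp (θ * (n * μ.real E))) ≤
      expMoment (Measure.pi fun _ : Fin n => μ) (fun S => θ * hits S E) := by
  rw [expMoment_mul_hits μ hE, mul_left_comm, Real.exp_nat_mul]
  refine ENNReal.ofReal_le_ofReal (pow_le_pow_left₀ (Real.exp_pos _).le ?_ _)
  have hconvex := convexOn_exp.2 (Set.mem_univ 0) (Set.mem_univ θ)
    (sub_nonneg.2 (measureReal_le_one (μ := μ) (s := E))) measureReal_nonneg (by ring)
  simp only [smul_eq_mul, mul_zero, zero_add, Real.exp_zero, mul_one] at hconvex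
  rw [mul_comm θ]
  linarith

lemma expMoment_mul_hits_le (n : ℕ) (θ : ℝ) :
    expMoment (Measure.pi fun _ : Fin n => μ) (fun S => θ * hits S E) ≤
      ofReal (exp (n * (μ.real E * (exp θ - 1)))) := by
  rw [expMoment_mul_hits μ hE, Real.exp_nat_mul]
  have h0 : 0 ≤ μ.real E := measureReal_nonneg
  have h1 : μ.real E ≤ 1 := measureReal_le_one
  refine ENNReal.ofReal_le_ofReal (pow_le_pow_left₀ ?_ ?_ _)
  · nlinarith [Real.exp_pos θ]
  · linarith [Real.add_one_le_exp (μ.real E * (exp θ - 1))]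

lemma expMoment_min_hits_sub_le_one {a b c l : ℝ} (hc : 0 ≤ c) (hl : 0 ≤ l) (hn : 0 < n)
    (hlc : l * c ≤ a * n) (ha : a ≤ 1) :
    expMoment (Measure.pi fun _ : Fin n => μ) (fun S =>
      l * (min (c * (hits S E / n)) b - (1 + a) * c * μ.real E)) ≤ 1 := by
  have hn' : (0 : ℝ) < n := by exact_mod_cast hn
  set θ := l * c / n with hθ
  have hrate : n * (μ.real E * (exp θ - 1)) ≤ l * ((1 + a) * c * μ.real E) := by
    calc n * (μ.real E * (exp θ - 1)) ≤ n * (μ.real E * (θ * (1 + a))) := by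
          gcongr
          exact exp_sub_one_le_mul (by positivity) ((div_le_iff₀ hn').2 hlc) ha
      _ = l * ((1 + a) * c * μ.real E) := by rw [hθ]; field_simp
  calc _ ≤ expMoment (Measure.pi fun _ : Fin n => μ)
        (fun S => -(l * ((1 + a) * c * μ.real E)) + θ * hits S E) := expMoment_mono fun S => by
          have : l * min (c * (hits S E / n)) b ≤ l * (c * (hits S E / n)) := by
            gcongr; exact min_le_left _ _
          rw [hθ, show l * c / n * hits S E = l * (c * (hits S E / n)) by ring]
          linarith
    _ ≤ ofReal (exp (-(l * ((1 + a) * c * μ.real E)))) *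
          ofReal (exp (n * (μ.real E * (exp θ - 1)))) := by
        rw [expMoment_const_add]; gcongr; exact expMoment_mul_hits_le μ hE n θ
    _ ≤ 1 := by
        rw [← ENNReal.ofReal_mul (Real.exp_pos _).le, ← Real.exp_add, ENNReal.ofReal_le_one,
          Real.exp_le_one_iff]
        linarith

lemma expMoment_sub_min_hits_le_one {a c l : ℝ} (ha : 0 < a) (ha1 : a ≤ 1 / 35) (hc : 0 ≤ c)
    (hl : 1 ≤ l * a ^ 2) (hn : 0 < n) (hlc : l * c ≤ a * n) :
    expMoment (Measure.pi fun _ : Fin n => μ) (fun S =>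
      l * ((1 - 12 / 5 * a) * min (c * μ.real E) a - a ^ 3 - min (c * (hits S E / n)) a)) ≤ 1 := by
  have hl0 : 0 < l := pos_of_mul_pos_left (zero_lt_one.trans_le hl) (sq_nonneg a)
  have hn' : (0 : ℝ) < n := by exact_mod_cast hn
  set θ := l * c / n with hθ
  set K := l * ((1 - 12 / 5 * a) * min (c * μ.real E) a - a ^ 3)
  have hpt : ∀ S : Fin n → Z, ofReal (exp (-(l * min (c * (hits S E / n)) a))) ≤
      ofReal (exp (-θ * hits S E)) + ofReal (exp (-(l * a))) := by
    intro S
    rcases min_choice (c * (hits S E / n)) a with h | h <;> rw [h]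
    · rw [show -(l * (c * (hits S E / n))) = -θ * hits S E by rw [hθ]; ring]
      exact le_self_add
    · exact le_add_self
  have hrate : n * (μ.real E * (exp (-θ) - 1)) ≤ -(l * (c * μ.real E) * (1 - a)) := by
    calc n * (μ.real E * (exp (-θ) - 1)) ≤ n * (μ.real E * -(θ * (1 - a))) := by
          gcongr
          exact exp_neg_sub_one_le_neg_mul (by positivity) ((div_le_iff₀ hn').2 hlc) (by linarith)
      _ = -(l * (c * μ.real E) * (1 - a)) := by rw [hθ]; field_simp
  calc _ = ofReal (exp K) * expMoment (Measure.pi fun _ : Fin n => μ)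
        (fun S => -(l * min (c * (hits S E / n)) a)) := by
        rw [← expMoment_const_add]; congr! 2; ring
    _ ≤ ofReal (exp K) * (expMoment (Measure.pi fun _ : Fin n => μ)
          (fun S => -θ * hits S E) + ofReal (exp (-(l * a)))) := by
        gcongr
        refine (lintegral_mono hpt).trans_eq ?_
        rw [lintegral_add_right _ measurable_const, lintegral_const, measure_univ, mul_one]; rfl
    _ ≤ ofReal (exp K) * (ofReal (exp (-(l * (c * μ.real E) * (1 - a)))) +
          ofReal (exp (-(l * a)))) := by
        gcongr
        exact (expMoment_mul_hits_le μ hE n (-θ)).trans (ENNReal.ofReal_le_ofReal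
          (Real.exp_le_exp.2 hrate))
    _ ≤ ofReal (exp K) * ofReal (exp (-K)) := by
        rw [← ENNReal.ofReal_add (Real.exp_pos _).le (Real.exp_pos _).le]
        gcongr
        exact exp_neg_add_exp_neg_le ha ha1 hl (mul_nonneg hc measureReal_nonneg)
    _ = 1 := by rw [← ENNReal.ofReal_mul (Real.exp_pos _).le, ← Real.exp_add]; simp

end Hits

section Errors

variable {X Y : Type*} {n : ℕ}

/-- The set of the labelled points that `f` mislabels. -/
def errSet (f : X → Bool) : Set (X × Bool) := {p | f p.1 ≠ p.2}

lemma empErr_eq (S : Fin n → X × Bool) (f : X → Bool) : empErr S f = hits S (errSet f) / n := by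
  simp only [empErr, hits, errSet, Set.indicator_apply, Pi.one_apply, Set.mem_ofPred_eq,
    Finset.sum_boole]

lemma empErr_nonneg (S : Fin n → X × Bool) (f : X → Bool) : 0 ≤ empErr S f := by
  unfold empErr; positivity

variable [MeasurableSpace X] [MeasurableSpace Y]

lemma measurableSet_errSet {f : X → Bool} (hf : Measurable f) : MeasurableSet (errSet f) :=
  (measurableSet_eq_fun (hf.comp measurable_fst) measurable_snd).compl

variable {O : Y → X → Bool}

lemma measurableSet_mem_errSet (hO : Measurable (Function.uncurry O)) :
    MeasurableSet {q : Y × (X × Bool) | q.2 ∈ errSet (O q.1)} :=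
  (measurableSet_eq_fun (hO.comp (by fun_prop : Measurable fun q : Y × (X × Bool) => (q.1, q.2.1)))
    (by fun_prop)).compl

lemma measurable_hits_errSet (hO : Measurable (Function.uncurry O)) {S : Y → Fin n → X × Bool}
    (hS : Measurable S) : Measurable fun y => hits (S y) (errSet (O y)) :=
  Finset.measurable_sum _ fun j _ =>
    (measurable_one.indicator (measurableSet_mem_errSet hO)).comp (by fun_prop : Measurable
      fun y => (y, S y j))

lemma measurable_empErr (hO : Measurable (Function.uncurry O)) {S : Y → Fin n → X × Bool}
    (hS : Measurable S) : Measurable fun y => empErr (S y) (O y) := by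
  simp only [empErr_eq]
  exact (measurable_hits_errSet hO hS).div_const _

lemma measurable_err (μ : Measure (X × Bool)) [SFinite μ] (hO : Measurable (Function.uncurry O)) :
    Measurable fun y => err μ (O y) :=
  (measurable_measure_prodMk_left (ν := μ) (measurableSet_mem_errSet hO)).ennreal_toReal

end Errors

section SauerShelah

variable {X ι : Type*} {F : Set (X → Bool)} {d : ℕ}

/-- The upper half of `HasVCDim`: the VC dimension of `F` is at most `d`. -/
def VCDimLE (F : Set (X → Bool)) (d : ℕ) : Prop := ∀ A : Finset X, Shatters F A → A.card ≤ d

variable [Fintype ι]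

open Classical in
/-- The error patterns of `F` on the labelled points `z`: the sets of the indices of the points that
one member of `F` mislabels. -/
noncomputable def errPatterns (F : Set (X → Bool)) (z : ι → X × Bool) : Finset (Finset ι) :=
  univ.filter fun P => ∃ f ∈ F, z ⁻¹' errSet f = P

variable {z : ι → X × Bool}

open Classical in
lemma exists_errSet_of_shatters {B : Finset ι} (hB : (errPatterns F z).Shatters B) (P : ι → Prop) :
    ∃ f ∈ F, ∀ i ∈ B, z i ∈ errSet f ↔ P i := by
  obtain ⟨u, hu, hBu⟩ := hB (B.filter_subset P)
  obtain ⟨-, f, hf, hfu⟩ := Finset.mem_filter.1 hu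
  refine ⟨f, hf, fun i hi => ?_⟩
  have hmem := Finset.ext_iff.1 hBu i
  simp only [Finset.mem_inter, Finset.mem_filter, hi, true_and] at hmem
  rw [← hmem, ← Finset.mem_coe, ← hfu, Set.mem_preimage]

open Classical in
lemma injOn_fst_of_shatters {B : Finset ι} (hB : (errPatterns F z).Shatters B) :
    Set.InjOn (fun i => (z i).1) B := by
  intro i hi j hj (hij : (z i).1 = (z j).1)
  by_contra hne
  obtain ⟨f, -, hf⟩ := exists_errSet_of_shatters hB fun _ => False
  obtain ⟨g, -, hg⟩ := exists_errSet_of_shatters hB fun l => l = i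
  have hfi : f (z i).1 = (z i).2 := not_not.1 ((hf i hi).not.2 id)
  have hfj : f (z j).1 = (z j).2 := not_not.1 ((hf j hj).not.2 id)
  have hgi : g (z i).1 ≠ (z i).2 := (hg i hi).2 rfl
  have hgj : g (z j).1 = (z j).2 := not_not.1 ((hg j hj).not.2 (Ne.symm hne))
  exact hgi (by rw [← hfi, hij, hfj, hgj])

open Classical in
lemma card_le_of_shatters_errPatterns (hd : VCDimLE F d) {B : Finset ι}
    (hB : (errPatterns F z).Shatters B) : B.card ≤ d := by
  rw [← Finset.card_image_of_injOn (injOn_fst_of_shatters hB)]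
  refine hd _ fun g => ?_
  obtain ⟨f, hf, hfg⟩ := exists_errSet_of_shatters hB fun i => z i ∈ errSet g
  refine ⟨f, hf, Finset.forall_mem_image.2 fun i hi => ?_⟩
  have hne : f (z i).1 ≠ (z i).2 ↔ g (z i).1 ≠ (z i).2 := hfg i hi
  revert hne
  cases f (z i).1 <;> cases g (z i).1 <;> cases (z i).2 <;> simp

lemma sum_choose_le_inv_pow_mul_exp {v m : ℕ} (hvd : v ≤ d) (hvm : v ≤ m) {x : ℝ} (hx : 0 < x)
    (hx1 : x ≤ 1) :
    ∑ k ∈ Finset.Iic v, (m.choose k : ℝ) ≤ x⁻¹ ^ d * exp (x * m) := by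
  have hterm : ∀ k ≤ v, (m.choose k : ℝ) ≤ x⁻¹ ^ d * (x ^ k * m.choose k) := by
    intro k hk
    have hpow : 1 ≤ x⁻¹ ^ d * x ^ k := by
      rw [inv_pow, ← div_eq_inv_mul, one_le_div (by positivity)]
      exact pow_le_pow_of_le_one hx.le hx1 (hk.trans hvd)
    rw [← mul_assoc]
    exact le_mul_of_one_le_left (Nat.cast_nonneg _) hpow
  calc ∑ k ∈ Finset.Iic v, (m.choose k : ℝ)
      ≤ ∑ k ∈ Finset.Iic v, x⁻¹ ^ d * (x ^ k * m.choose k) :=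
        Finset.sum_le_sum fun k hk => hterm k (Finset.mem_Iic.1 hk)
    _ ≤ ∑ k ∈ Finset.range (m + 1), x⁻¹ ^ d * (x ^ k * m.choose k) := by
        refine Finset.sum_le_sum_of_subset_of_nonneg (fun k hk => ?_) fun k _ _ => by positivity
        exact Finset.mem_range_succ_iff.2 ((Finset.mem_Iic.1 hk).trans hvm)
    _ = x⁻¹ ^ d * (x + 1) ^ m := by rw [← Finset.mul_sum, add_pow]; simp only [one_pow, mul_one]
    _ ≤ x⁻¹ ^ d * exp (x * m) := by
        rw [mul_comm x, Real.exp_nat_mul]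
        gcongr
        exact Real.add_one_le_exp x

lemma card_errPatterns_le (hd : VCDimLE F d) (z : ι → X × Bool) {x : ℝ} (hx : 0 < x)
    (hx1 : x ≤ 1) :
    ((errPatterns F z).card : ℝ) ≤ x⁻¹ ^ d * exp (x * Fintype.card ι) := by
  classical
  have hvd : (errPatterns F z).vcDim ≤ d := Finset.sup_le fun s hs =>
    card_le_of_shatters_errPatterns hd (Finset.mem_shatterer.1 hs)
  have hvm : (errPatterns F z).vcDim ≤ Fintype.card ι := Finset.sup_le fun s _ => s.card_le_univ
  have hsauer := (Finset.card_le_card_shatterer _).trans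
    (Finset.card_shatterer_le_sum_vcDim (𝒜 := errPatterns F z))
  exact (by exact_mod_cast hsauer :
    ((errPatterns F z).card : ℝ) ≤ _).trans (sum_choose_le_inv_pow_mul_exp hvd hvm hx hx1)

end SauerShelah

section Symmetrization

variable {Z : Type*} {n : ℕ}

/-- Exchange the two components of the pairs whose index is marked by `σ`. -/
def swapPairs (σ : Fin n → Bool) (W : Fin n → Z × Z) : Fin n → Z × Z :=
  fun j => bif σ j then (W j).swap else W j

/-- The two samples `j ↦ (W j).1` and `j ↦ (W j).2` as one family of points. -/
def pairPoint (W : Fin n → Z × Z) (i : Fin n × Bool) : Z := bif i.2 then (W i.1).2 else (W i.1).1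

lemma swapPairs_fst (σ : Fin n → Bool) (W : Fin n → Z × Z) (j : Fin n) :
    (swapPairs σ W j).1 = pairPoint W (j, σ j) := by
  unfold swapPairs pairPoint; cases σ j <;> rfl

lemma swapPairs_snd (σ : Fin n → Bool) (W : Fin n → Z × Z) (j : Fin n) :
    (swapPairs σ W j).2 = pairPoint W (j, !σ j) := by
  unfold swapPairs pairPoint; cases σ j <;> rfl

lemma measurePreserving_swapPairs [MeasurableSpace Z] (μ : Measure Z) [SigmaFinite μ]
    (σ : Fin n → Bool) :
    MeasurePreserving (swapPairs (Z := Z) σ) (Measure.pi fun _ => μ.prod μ)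
      (Measure.pi fun _ => μ.prod μ) :=
  measurePreserving_pi (fun _ => μ.prod μ) (fun _ => μ.prod μ)
    (f := fun j p => bif σ j then p.swap else p) fun j => by
      cases σ j
      · exact MeasurePreserving.id _
      · exact Measure.measurePreserving_swap

lemma lintegral_le_of_sum_swapPairs_le [MeasurableSpace Z] (μ : Measure Z) [IsProbabilityMeasure μ]
    {G : (Fin n → Z × Z) → ENNReal} (hG : Measurable G) {c : ENNReal}
    (h : ∀ W, ∑ σ, G (swapPairs σ W) ≤ 2 ^ n * c) :
    ∫⁻ W, G W ∂(Measure.pi fun _ => μ.prod μ) ≤ c := by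
  have hsum : 2 ^ n * ∫⁻ W, G W ∂(Measure.pi fun _ => μ.prod μ) ≤ 2 ^ n * c := by
    calc _ = ∑ σ : Fin n → Bool, ∫⁻ W, G (swapPairs σ W) ∂(Measure.pi fun _ => μ.prod μ) := by
          simp only [(measurePreserving_swapPairs μ _).lintegral_comp hG, Finset.sum_const,
            Finset.card_univ, Fintype.card_pi_const, Fintype.card_bool, nsmul_eq_mul, Nat.cast_pow,
            Nat.cast_ofNat]
      _ = ∫⁻ W, ∑ σ, G (swapPairs σ W) ∂(Measure.pi fun _ => μ.prod μ) :=
          (lintegral_finsetSum _ fun σ _ =>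
            hG.comp (measurePreserving_swapPairs μ σ).measurable).symm
      _ ≤ ∫⁻ _, 2 ^ n * c ∂(Measure.pi fun _ : Fin n => μ.prod μ) := lintegral_mono h
      _ = 2 ^ n * c := by rw [lintegral_const, measure_univ, mul_one]
  exact (ENNReal.mul_le_mul_iff_right (by simp) (by simp)).1 hsum

variable {γ τ : ℝ}

lemma exp_add_exp_neg_le_two (hγ : 0 ≤ γ) (hγ1 : γ ≤ 1) (hτ : 0 ≤ τ) (hτγ : 5 * τ ≤ γ) :
    exp τ + exp (-(τ * (1 + γ))) ≤ 2 := by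
  have h1 := (abs_le.1 (Real.abs_exp_sub_one_sub_id_le (x := τ)
    (abs_le.2 ⟨by linarith, by linarith⟩))).2
  have h2 := (abs_le.1 (Real.abs_exp_sub_one_sub_id_le (x := -(τ * (1 + γ)))
    (abs_le.2 ⟨by nlinarith, by nlinarith⟩))).2
  have h3 : (-(τ * (1 + γ))) ^ 2 ≤ 4 * τ ^ 2 := by
    have : (1 + γ) ^ 2 ≤ 4 := by nlinarith
    nlinarith [sq_nonneg τ]
  nlinarith

lemma sum_exp_indicator_swap_le_two (hγ : 0 ≤ γ) (hγ1 : γ ≤ 1) (hτ : 0 ≤ τ) (hτγ : 5 * τ ≤ γ)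
    {ι : Type*} (P : Set ι) (z : Bool → ι) :
    ∑ s, exp (τ * (P.indicator 1 (z !s) - (1 + γ) * P.indicator 1 (z s))) ≤ 2 := by
  have hone := exp_add_exp_neg_le_two hγ hγ1 hτ hτγ
  have hboth : exp (τ * (1 - (1 + γ))) ≤ 1 := Real.exp_le_one_iff.2 (by nlinarith)
  rw [← mul_neg] at hone
  rw [Fintype.sum_bool]
  by_cases ht : z true ∈ P <;> by_cases hf : z false ∈ P <;>
    simp only [ht, hf, Bool.not_true, Bool.not_false, Set.indicator_of_mem,
      Set.indicator_of_notMem, not_false_eq_true, Pi.one_apply, mul_one, mul_zero, sub_zero,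
      zero_sub, Real.exp_zero] <;> linarith

lemma sum_exp_sum_indicator_swap_le (hγ : 0 ≤ γ) (hγ1 : γ ≤ 1) (hτ : 0 ≤ τ) (hτγ : 5 * τ ≤ γ)
    (P : Set (Fin n × Bool)) :
    ∑ σ : Fin n → Bool,
      exp (τ * ∑ j, (P.indicator 1 (j, !σ j) - (1 + γ) * P.indicator 1 (j, σ j))) ≤ 2 ^ n := by
  simp only [Finset.mul_sum, Real.exp_sum]
  rw [← Fintype.prod_sum fun j s =>
    exp (τ * (P.indicator 1 (j, !s) - (1 + γ) * P.indicator 1 (j, s)))]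
  calc _ ≤ ∏ _j : Fin n, (2 : ℝ) := Finset.prod_le_prod
        (fun j _ => Finset.sum_nonneg fun s _ => (Real.exp_pos _).le)
        (fun j _ => sum_exp_indicator_swap_le_two hγ hγ1 hτ hτγ P (Prod.mk j))
    _ = 2 ^ n := by rw [Finset.prod_const, Finset.card_univ, Fintype.card_fin]

variable {X : Type*}

/-- The excess of the number of errors on the second (ghost) sample over `1 + γ` times the number of
errors on the first one, for the classifier that `O` learns from the first sample. -/
noncomputable def ghostGap (O : (Fin n → X × Bool) → X → Bool) (γ : ℝ)
    (W : Fin n → (X × Bool) × (X × Bool)) : ℝ :=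
  hits (fun j => (W j).2) (errSet (O fun j => (W j).1)) -
    (1 + γ) * hits (fun j => (W j).1) (errSet (O fun j => (W j).1))

lemma ghostGap_swapPairs (O : (Fin n → X × Bool) → X → Bool) (γ : ℝ)
    (W : Fin n → (X × Bool) × (X × Bool)) (σ : Fin n → Bool) :
    ghostGap O γ (swapPairs σ W) =
      ∑ j, ((pairPoint W ⁻¹' errSet (O fun j => (swapPairs σ W j).1)).indicator 1 (j, !σ j) -
        (1 + γ) * (pairPoint W ⁻¹' errSet (O fun j => (swapPairs σ W j).1)).indicator 1
          (j, σ j)) := by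
  simp only [ghostGap, hits, Finset.sum_sub_distrib, Finset.mul_sum]
  congr! 3
  · rw [swapPairs_snd]; rfl
  · rw [swapPairs_fst]; rfl

lemma sum_exp_ghostGap_swapPairs_le {F : Set (X → Bool)} {O : (Fin n → X × Bool) → X → Bool}
    (hOF : ∀ S, O S ∈ F) (hγ : 0 ≤ γ) (hγ1 : γ ≤ 1) (hτ : 0 ≤ τ) (hτγ : 5 * τ ≤ γ)
    (W : Fin n → (X × Bool) × (X × Bool)) :
    ∑ σ, exp (τ * ghostGap O γ (swapPairs σ W)) ≤
      2 ^ n * (errPatterns F (pairPoint W)).card := by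
  classical
  let gap (σ : Fin n → Bool) (P : Finset (Fin n × Bool)) : ℝ :=
    ∑ j, ((P : Set _).indicator 1 (j, !σ j) - (1 + γ) * (P : Set _).indicator 1 (j, σ j))
  have hpattern : ∀ σ, ∃ P ∈ errPatterns F (pairPoint W),
      ghostGap O γ (swapPairs σ W) = gap σ P := fun σ => by
    refine ⟨(pairPoint W ⁻¹' errSet (O fun j => (swapPairs σ W j).1)).toFinset,
      Finset.mem_filter.2 ⟨Finset.mem_univ _, _, hOF _, (Set.coe_toFinset _).symm⟩, ?_⟩
    simp only [gap, Set.coe_toFinset, ghostGap_swapPairs]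
  calc ∑ σ, exp (τ * ghostGap O γ (swapPairs σ W))
      ≤ ∑ σ, ∑ P ∈ errPatterns F (pairPoint W), exp (τ * gap σ P) :=
        Finset.sum_le_sum fun σ _ => by
          obtain ⟨P, hP, hgap⟩ := hpattern σ
          rw [hgap]
          exact Finset.single_le_sum (f := fun P => exp (τ * gap σ P))
            (fun _ _ => (Real.exp_pos _).le) hP
    _ = ∑ P ∈ errPatterns F (pairPoint W), ∑ σ, exp (τ * gap σ P) := Finset.sum_comm
    _ ≤ ∑ _P ∈ errPatterns F (pairPoint W), (2 : ℝ) ^ n := Finset.sum_le_sum fun P _ =>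
        sum_exp_sum_indicator_swap_le hγ hγ1 hτ hτγ (P : Set (Fin n × Bool))
    _ = _ := by rw [Finset.sum_const, nsmul_eq_mul, mul_comm]

variable [MeasurableSpace X] {O : (Fin n → X × Bool) → X → Bool}

lemma measurable_ghostGap (hO : Measurable (Function.uncurry O)) (γ : ℝ) :
    Measurable (ghostGap O γ) := by
  have hO' : Measurable (Function.uncurry
      fun W : Fin n → (X × Bool) × (X × Bool) => O fun j => (W j).1) :=
    hO.comp (by fun_prop : Measurable fun q : (Fin n → (X × Bool) × (X × Bool)) × X =>
      ((fun j => (q.1 j).1 : Fin n → X × Bool), q.2))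
  exact (measurable_hits_errSet hO' (by fun_prop)).sub
    ((measurable_hits_errSet hO' (by fun_prop)).const_mul _)

variable (μ : Measure (X × Bool)) [IsProbabilityMeasure μ]

/- By Jensen's inequality over the ghost sample, whose expected number of hits of the error set is
`n * err μ (O S)`. -/
lemma expMoment_err_sub_le_expMoment_ghostGap (hO : Measurable (Function.uncurry O)) (γ τ : ℝ) :
    expMoment (Measure.pi fun _ : Fin n => μ)
        (fun S => τ * (n * err μ (O S) - (1 + γ) * hits S (errSet (O S)))) ≤
      expMoment (Measure.pi fun _ : Fin n => μ.prod μ) (fun W => τ * ghostGap O γ W) := by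
  have hghost : ∀ S, ofReal (exp (τ * (n * err μ (O S) - (1 + γ) * hits S (errSet (O S))))) ≤
      expMoment (Measure.pi fun _ : Fin n => μ)
        (fun S' => τ * ghostGap O γ fun j => (S j, S' j)) := by
    intro S
    have hE := measurableSet_errSet (hO.of_uncurry_left (x := S))
    calc _ = ofReal (exp (-(τ * ((1 + γ) * hits S (errSet (O S)))))) *
          ofReal (exp (τ * (n * μ.real (errSet (O S))))) := by
          rw [← ENNReal.ofReal_mul (Real.exp_pos _).le, ← Real.exp_add, err, errSet]
          ring_nf
      _ ≤ ofReal (exp (-(τ * ((1 + γ) * hits S (errSet (O S)))))) *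
          expMoment (Measure.pi fun _ : Fin n => μ) (fun S' => τ * hits S' (errSet (O S))) := by
          gcongr; exact exp_mul_le_expMoment_mul_hits μ hE n τ
      _ = _ := by
          rw [← expMoment_const_add]
          congr! 2 with S'
          rw [ghostGap]
          ring
  have hmeas : Measurable fun p : (Fin n → X × Bool) × (Fin n → X × Bool) =>
      τ * ghostGap O γ fun j => (p.1 j, p.2 j) :=
    ((measurable_ghostGap hO γ).comp (by fun_prop)).const_mul τ
  refine (lintegral_mono hghost).trans_eq ?_
  refine (lintegral_prod (fun p : (Fin n → X × Bool) × (Fin n → X × Bool) =>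
    ofReal (exp (τ * ghostGap O γ fun j => (p.1 j, p.2 j))))
    hmeas.exp.ennreal_ofReal.aemeasurable).symm.trans ?_
  exact (expMoment_comp_measurePreserving (measurePreserving_arrowProdEquivProdArrow (X × Bool)
    (X × Bool) (Fin n) (fun _ => μ) (fun _ => μ)) hmeas).symm

lemma expMoment_err_sub_le {F : Set (X → Bool)} {d : ℕ} (hd : VCDimLE F d) (hOF : ∀ S, O S ∈ F)
    (hO : Measurable (Function.uncurry O)) (hγ : 0 ≤ γ) (hγ1 : γ ≤ 1) (hτ : 0 ≤ τ)
    (hτγ : 5 * τ ≤ γ) {x : ℝ} (hx : 0 < x) (hx1 : x ≤ 1) :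
    expMoment (Measure.pi fun _ : Fin n => μ)
        (fun S => τ * (n * err μ (O S) - (1 + γ) * hits S (errSet (O S)))) ≤
      ofReal (x⁻¹ ^ d * exp (x * (2 * n))) := by
  refine (expMoment_err_sub_le_expMoment_ghostGap μ hO γ τ).trans
    (lintegral_le_of_sum_swapPairs_le μ (by have := measurable_ghostGap hO γ; fun_prop) fun W => ?_)
  have hcard : (Fintype.card (Fin n × Bool) : ℝ) = 2 * n := by simp [mul_comm]
  calc ∑ σ, ofReal (exp (τ * ghostGap O γ (swapPairs σ W)))
      = ofReal (∑ σ, exp (τ * ghostGap O γ (swapPairs σ W))) :=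
        (ENNReal.ofReal_sum_of_nonneg fun σ _ => (Real.exp_pos _).le).symm
    _ ≤ ofReal (2 ^ n * (x⁻¹ ^ d * exp (x * (2 * n)))) := by
        rw [← hcard]
        exact ENNReal.ofReal_le_ofReal
          ((sum_exp_ghostGap_swapPairs_le hOF hγ hγ1 hτ hτγ W).trans
            (by gcongr; exact card_errPatterns_le hd _ hx hx1))
    _ = _ := by rw [ENNReal.ofReal_mul (by positivity), ENNReal.ofReal_pow two_pos.le]; simp

end Symmetrization

section Deviation

variable {X : Type*} [MeasurableSpace X] {n d : ℕ} (μ : Measure (X × Bool)) [IsProbabilityMeasure μ]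

lemma measure_empErr_lt_err_le {F : Set (X → Bool)} (hd : VCDimLE F d)
    {O : (Fin n → X × Bool) → X → Bool} (hOF : ∀ S, O S ∈ F) (hO : Measurable (Function.uncurry O))
    {γ e δ : ℝ} (hγ : 0 < γ) (hγ1 : γ ≤ 1) (he : 0 < e) (he1 : e ≤ 1) (hδ : 0 < δ) (hn : 0 < n)
    (hsize : 10 * (d * log (20 / (γ * e)) + log (1 / δ)) ≤ γ * e * n) :
    (Measure.pi fun _ : Fin n => μ) {S | (1 + γ) * empErr S (O S) + e < err μ (O S)} ≤
      ofReal δ := by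
  have hn' : (0 : ℝ) < n := by exact_mod_cast hn
  have hgap : ∀ S : Fin n → X × Bool, (1 + γ) * empErr S (O S) + e < err μ (O S) →
      γ / 5 * (e * n) < γ / 5 * (n * err μ (O S) - (1 + γ) * hits S (errSet (O S))) := by
    intro S hS
    have hhits : hits S (errSet (O S)) = n * empErr S (O S) := by
      rw [empErr_eq, mul_div_cancel₀ _ hn'.ne']
    rw [hhits]
    nlinarith [mul_lt_mul_of_pos_left hS (mul_pos hγ hn')]
  have hmeas : Measurable fun S : Fin n → X × Bool =>
      γ / 5 * (n * err μ (O S) - (1 + γ) * hits S (errSet (O S))) := by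
    have := measurable_err μ hO
    have := measurable_hits_errSet hO measurable_id
    fun_prop
  have hpow : (γ * e / 20)⁻¹ ^ d = exp (d * log (20 / (γ * e))) := by
    rw [Real.exp_nat_mul, Real.exp_log (by positivity), inv_div]
  calc _ ≤ _ := measure_mono hgap
    _ ≤ _ := measure_lt_le_exp_mul_expMoment hmeas _
    _ ≤ ofReal (exp (-(γ / 5 * (e * n)))) * ofReal (_ * exp (γ * e / 20 * (2 * n))) := by
        gcongr
        exact expMoment_err_sub_le μ hd hOF hO hγ.le hγ1 (by positivity) (by linarith)
          (by positivity) (by nlinarith)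
    _ ≤ ofReal δ := by
        rw [hpow, ← ENNReal.ofReal_mul (Real.exp_pos _).le, ← Real.exp_add, ← Real.exp_add]
        refine ENNReal.ofReal_le_ofReal ((Real.le_log_iff_exp_le hδ).1 ?_)
        rw [one_div, Real.log_inv] at hsize
        linarith

lemma measure_lt_empErr_le {f : X → Bool} (hf : Measurable f) {a e θ δ : ℝ} (ha : 0 < a)
    (ha1 : a ≤ 1) (hθ : err μ f ≤ θ) (hδ : 0 < δ) (hn : 0 < n) (hsize : log (1 / δ) ≤ a * e * n) :
    (Measure.pi fun _ : Fin n => μ) {S | (1 + a) * θ + e < empErr S f} ≤ ofReal δ := by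
  have hn' : (0 : ℝ) < n := by exact_mod_cast hn
  have hE := measurableSet_errSet hf
  have hrate : n * (μ.real (errSet f) * (exp a - 1)) ≤ n * (θ * (a * (1 + a))) := by
    have hexp := exp_sub_one_le_mul ha.le le_rfl ha1
    have hexp0 : 0 ≤ exp a - 1 := by linarith [Real.one_le_exp ha.le]
    have hθ0 : 0 ≤ θ := measureReal_nonneg.trans hθ
    gcongr
    exact hθ
  calc _ ≤ (Measure.pi fun _ : Fin n => μ)
          {S | a * (n * ((1 + a) * θ + e)) < a * hits S (errSet f)} :=
        measure_mono fun S (hS : (1 + a) * θ + e < empErr S f) => by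
          rw [empErr_eq, lt_div_iff₀' hn'] at hS
          exact mul_lt_mul_of_pos_left hS ha
    _ ≤ _ := measure_lt_le_exp_mul_expMoment (by fun_prop (disch := exact hE)) _
    _ ≤ ofReal (exp (-(a * (n * ((1 + a) * θ + e))))) *
          ofReal (exp (n * (μ.real (errSet f) * (exp a - 1)))) := by
        gcongr; exact expMoment_mul_hits_le μ hE n a
    _ ≤ ofReal δ := by
        rw [← ENNReal.ofReal_mul (Real.exp_pos _).le, ← Real.exp_add]
        refine ENNReal.ofReal_le_ofReal ((Real.le_log_iff_exp_le hδ).1 ?_)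
        rw [one_div, Real.log_inv] at hsize
        linarith

end Deviation

section WeightedAvg

variable {ι : Type*} [Fintype ι] {w y z : ι → ℝ}

/-- The average of `z` with weights proportional to `w`. The error on the mixture and the relative
growth of the potential in a round are averages of this kind. -/
noncomputable def weightedAvg (w z : ι → ℝ) : ℝ := ∑ i, w i / (∑ j, w j) * z i

lemma div_sum_nonneg (hw : ∀ i, 0 < w i) (i : ι) : 0 ≤ w i / ∑ j, w j :=
  div_nonneg (hw i).le (Finset.sum_nonneg fun j _ => (hw j).le)

lemma weightedAvg_nonneg (hw : ∀ i, 0 < w i) (hz : ∀ i, 0 ≤ z i) : 0 ≤ weightedAvg w z :=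
  Finset.sum_nonneg fun i _ => mul_nonneg (div_sum_nonneg hw i) (hz i)

lemma weightedAvg_mono (hw : ∀ i, 0 < w i) (hyz : ∀ i, y i ≤ z i) :
    weightedAvg w y ≤ weightedAvg w z :=
  Finset.sum_le_sum fun i _ => mul_le_mul_of_nonneg_left (hyz i) (div_sum_nonneg hw i)

lemma mul_weightedAvg_sub (a c : ℝ) :
    a * (weightedAvg w y - c * weightedAvg w z) = weightedAvg w fun i => a * (y i - c * z i) := by
  simp only [weightedAvg, Finset.mul_sum, ← Finset.sum_sub_distrib]
  exact Finset.sum_congr rfl fun i _ => by ring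

variable [Nonempty ι]

lemma sum_div_sum_eq_one (hw : ∀ i, 0 < w i) : ∑ i, w i / ∑ j, w j = 1 := by
  rw [← Finset.sum_div, div_self (Finset.sum_pos (fun i _ => hw i) Finset.univ_nonempty).ne']

lemma weightedAvg_const (hw : ∀ i, 0 < w i) (c : ℝ) : weightedAvg w (fun _ => c) = c := by
  rw [weightedAvg, ← Finset.sum_mul, sum_div_sum_eq_one hw, one_mul]

lemma sum_mul_one_add (hw : ∀ i, 0 < w i) :
    ∑ i, w i * (1 + z i) = (∑ i, w i) * (1 + weightedAvg w z) := by
  have hΦ : ∑ i, w i ≠ 0 := (Finset.sum_pos (fun i _ => hw i) Finset.univ_nonempty).ne'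
  simp only [weightedAvg, mul_add, mul_one, Finset.sum_add_distrib, Finset.mul_sum]
  congr! 2 with i
  field_simp

end WeightedAvg

section Weights

variable {X : Type*} {k nS nT : ℕ} (O : LearningRule X) {α ε : ℝ}

lemma aPar_pos (hα : 0 < α) : 0 < aPar α := by unfold aPar; positivity

lemma ePar_pos (hε : 0 < ε) : 0 < ePar ε := by unfold ePar; positivity

lemma score_nonneg (hα : 0 < α) (hε : 0 < ε) (R : RoundData X k nS nT) (i : Fin k) :
    0 ≤ score O α ε R i := by
  have := aPar_pos hα
  have := ePar_pos hε
  have := empErr_nonneg (R.2 i) (O nS R.1)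
  have := empErr_nonneg R.1 (O nS R.1)
  unfold score
  positivity

lemma weight_pos (hα : 0 < α) (hε : 0 < ε) (r : ℕ) (h : Fin r → RoundData X k nS nT)
    (i : Fin k) : 0 < weight O α ε r h i := by
  induction r with
  | zero => simp [weight]
  | succ r ih =>
    have := score_nonneg O hα hε (h (Fin.last r)) i
    have := ih fun j => h j.castSucc
    rw [weight]
    positivity

variable (α ε)

/-- The weights with which round `j` of the run `h` starts. -/
noncomputable def weightAt {r : ℕ} (h : Fin r → RoundData X k nS nT) (j : Fin r) : Fin k → ℝ :=
  weight O α ε j fun l => h (Fin.castLE j.isLt.le l)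

/-- The sum, over the rounds of the run `h`, of a function of the initial weights and of the data of
a round. -/
noncomputable def runSum {M : Type*} [AddCommMonoid M]
    (g : (Fin k → ℝ) → RoundData X k nS nT → M) {r : ℕ} (h : Fin r → RoundData X k nS nT) : M :=
  ∑ j, g (weightAt O α ε h j) (h j)

variable {M : Type*} [AddCommMonoid M] (g : (Fin k → ℝ) → RoundData X k nS nT → M) {r : ℕ}

lemma runSum_succ (h : Fin (r + 1) → RoundData X k nS nT) :
    runSum O α ε g h = runSum O α ε g (fun j => h j.castSucc) +
      g (weight O α ε r fun j => h j.castSucc) (h (Fin.last r)) :=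
  Fin.sum_univ_castSucc _

lemma runSum_snoc (h : Fin r → RoundData X k nS nT) (R : RoundData X k nS nT) :
    runSum O α ε g (Fin.snoc (α := fun _ => RoundData X k nS nT) h R :
      Fin (r + 1) → RoundData X k nS nT) = runSum O α ε g h + g (weight O α ε r h) R := by
  simp only [runSum_succ, Fin.snoc_castSucc, Fin.snoc_last]

end Weights

section Measurability

variable {X : Type*} [MeasurableSpace X] {k nS nT : ℕ} {O : LearningRule X} (α ε : ℝ)

lemma IsMeasurableRule.comp {Y : Type*} [MeasurableSpace Y] (hO : IsMeasurableRule O) {n : ℕ}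
    {S : Y → Fin n → X × Bool} (hS : Measurable S) :
    Measurable (Function.uncurry fun y => O n (S y)) :=
  (hO n).comp ((hS.comp measurable_fst).prodMk measurable_snd)

lemma measurable_score (hO : IsMeasurableRule O) (i : Fin k) :
    Measurable fun R : RoundData X k nS nT => score O α ε R i := by
  have hf := hO.comp (measurable_fst : Measurable (Prod.fst : RoundData X k nS nT → _))
  have hT := measurable_empErr hf (S := fun R => R.2 i) (by fun_prop)
  have hS := measurable_empErr hf (S := fun R => R.1) (by fun_prop)
  unfold score
  fun_prop

lemma measurable_weight (hO : IsMeasurableRule O) (r : ℕ) :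
    Measurable fun h : Fin r → RoundData X k nS nT => weight O α ε r h := by
  induction r with
  | zero => exact measurable_const
  | succ r ih =>
    refine measurable_pi_iff.2 fun i => Measurable.mul ?_ (Measurable.const_add ?_ 1)
    · exact (measurable_pi_apply i).comp (ih.comp (by fun_prop))
    · exact (measurable_score α ε hO i).comp (measurable_pi_apply (Fin.last r))

lemma measurable_runSum {M : Type*} [AddCommMonoid M] [MeasurableSpace M] [MeasurableAdd₂ M]
    (hO : IsMeasurableRule O) {g : (Fin k → ℝ) → RoundData X k nS nT → M}
    (hg : Measurable (Function.uncurry g)) (r : ℕ) :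
    Measurable fun h : Fin r → RoundData X k nS nT => runSum O α ε g h :=
  Finset.measurable_sum _ fun j _ => hg.comp
    (((measurable_weight α ε hO j).comp (by fun_prop)).prodMk (measurable_pi_apply j))

lemma measurable_snoc {Z : Type*} [MeasurableSpace Z] (r : ℕ) :
    Measurable fun q : (Fin r → Z) × Z =>
      (Fin.snoc (α := fun _ => Z) q.1 q.2 : Fin (r + 1) → Z) := by
  refine measurable_pi_iff.2 fun j => ?_
  induction j using Fin.lastCases with
  | last => simpa only [Fin.snoc_last] using measurable_snd
  | cast j => simpa only [Fin.snoc_castSucc] using by fun_prop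

end Measurability

section Laws

variable {X : Type*} [MeasurableSpace X] {k : ℕ} (D : Fin k → Measure (X × Bool))

lemma lintegral_runLaw_succ_le {nS nT r : ℕ} {O : LearningRule X} {α ε : ℝ}
    (φ : (Fin (r + 1) → RoundData X k nS nT) → ENNReal) :
    ∫⁻ h, φ h ∂runLaw nS nT O α ε D (r + 1) ≤
      ∫⁻ h, ∫⁻ R, φ (Fin.snoc (α := fun _ => RoundData X k nS nT) h R)
        ∂roundLaw nS nT D (weight O α ε r h) ∂runLaw nS nT O α ε D r :=
  (Measure.lintegral_bind_le _ _ _).trans (lintegral_mono fun _ => lintegral_map_le _ _)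

variable [∀ i, IsProbabilityMeasure (D i)]

lemma err_mixture {w : Fin k → ℝ} (hw : ∀ i, 0 < w i) (f : X → Bool) :
    err (mixture w D) f = weightedAvg w fun i => err (D i) f := by
  simp only [err, weightedAvg, mixture, Measure.real, Measure.coe_finsetSum, Finset.sum_apply,
    Measure.smul_apply, smul_eq_mul]
  rw [ENNReal.toReal_sum fun i _ => ENNReal.mul_ne_top ENNReal.ofReal_ne_top (measure_ne_top _ _)]
  simp only [ENNReal.toReal_mul, ENNReal.toReal_ofReal (div_sum_nonneg hw _)]

variable [NeZero k]

lemma isProbabilityMeasure_mixture {w : Fin k → ℝ} (hw : ∀ i, 0 < w i) :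
    IsProbabilityMeasure (mixture w D) := by
  constructor
  simp only [mixture, Measure.coe_finsetSum, Finset.sum_apply, Measure.smul_apply,
    measure_univ, smul_eq_mul, mul_one]
  rw [← ENNReal.ofReal_sum_of_nonneg fun i _ => div_sum_nonneg hw i, sum_div_sum_eq_one hw,
    ENNReal.ofReal_one]

lemma isProbabilityMeasure_roundLaw {w : Fin k → ℝ} (hw : ∀ i, 0 < w i) (nS nT : ℕ) :
    IsProbabilityMeasure (roundLaw nS nT D w) := by
  have := isProbabilityMeasure_mixture D hw
  unfold roundLaw
  infer_instance

lemma measurable_pi_mixture {Y : Type*} [MeasurableSpace Y] {w : Y → Fin k → ℝ}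
    (hw : ∀ y i, 0 < w y i) (hwm : Measurable w) (n : ℕ) :
    Measurable fun y => Measure.pi fun _ : Fin n => mixture (w y) D := by
  have := fun y => isProbabilityMeasure_mixture D (hw y)
  refine Measurable.measure_of_isPiSystem_of_isProbabilityMeasure generateFrom_pi.symm
    isPiSystem_pi ?_
  rintro _ ⟨s, -, rfl⟩
  simp only [Measure.pi_pi]
  simp only [mixture, Measure.coe_finsetSum, Finset.sum_apply, Measure.smul_apply, smul_eq_mul]
  fun_prop

lemma measurable_roundLaw {Y : Type*} [MeasurableSpace Y] {w : Y → Fin k → ℝ}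
    (hw : ∀ y i, 0 < w y i) (hwm : Measurable w) (nS nT : ℕ) :
    Measurable fun y => roundLaw nS nT D (w y) := by
  have := fun y => isProbabilityMeasure_roundLaw D (hw y) nS nT
  refine Measurable.measure_of_isPiSystem_of_isProbabilityMeasure generateFrom_prod.symm
    isPiSystem_prod ?_
  rintro _ ⟨s, hs : MeasurableSet s, t, -, rfl⟩
  simp only [roundLaw, Measure.prod_prod]
  exact ((Measure.measurable_coe hs).comp (measurable_pi_mixture D hw hwm nS)).mul_const _

variable {α ε : ℝ} {nS nT : ℕ} {O : LearningRule X} (hα : 0 < α) (hε : 0 < ε)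
include hα hε

lemma isProbabilityMeasure_runLaw (hO : IsMeasurableRule O) (r : ℕ) :
    IsProbabilityMeasure (runLaw nS nT O α ε D r) := by
  induction r with
  | zero => exact Measure.dirac.isProbabilityMeasure
  | succ r ih =>
    have hw := weight_pos (k := k) (nS := nS) (nT := nT) O hα hε r
    have hround := fun h => isProbabilityMeasure_roundLaw D (hw h) nS nT
    have hsnoc := measurable_snoc (Z := RoundData X k nS nT) r
    let κ : ProbabilityTheory.Kernel (Fin r → RoundData X k nS nT) (RoundData X k nS nT) :=
      ⟨_, measurable_roundLaw D hw (measurable_weight α ε hO r) nS nT⟩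
    have : ProbabilityTheory.IsMarkovKernel κ := ⟨hround⟩
    refine isProbabilityMeasure_bind (Measurable.aemeasurable ?_) (ae_of_all _ fun h =>
      Measure.isProbabilityMeasure_map (hsnoc.comp measurable_prodMk_left).aemeasurable)
    refine Measure.measurable_of_measurable_coe _ fun s hs => ?_
    convert ProbabilityTheory.Kernel.measurable_kernel_prodMk_left (κ := κ) (hsnoc hs) with h
    exact Measure.map_apply (hsnoc.comp measurable_prodMk_left) hs

lemma expMoment_runSum_le_one (hO : IsMeasurableRule O)
    {g : (Fin k → ℝ) → RoundData X k nS nT → ℝ}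
    (hg : ∀ w, (∀ i, 0 < w i) → expMoment (roundLaw nS nT D w) (g w) ≤ 1) (r : ℕ) :
    expMoment (runLaw nS nT O α ε D r) (runSum O α ε g) ≤ 1 := by
  induction r with
  | zero =>
    have := isProbabilityMeasure_runLaw D (nS := nS) (nT := nT) hα hε hO 0
    simp [expMoment, runSum]
  | succ r ih =>
    refine (lintegral_runLaw_succ_le D _).trans (le_trans (lintegral_mono fun h => ?_) ih)
    calc _ = ofReal (exp (runSum O α ε g h)) *
          expMoment (roundLaw nS nT D (weight O α ε r h)) (g (weight O α ε r h)) := by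
          simp only [runSum_snoc]
          exact expMoment_const_add _ _
      _ ≤ ofReal (exp (runSum O α ε g h)) * 1 := by
          gcongr
          exact hg _ (weight_pos O hα hε r h)
      _ = _ := mul_one _

lemma runLaw_lt_runSum_le (hO : IsMeasurableRule O) {g : (Fin k → ℝ) → RoundData X k nS nT → ℝ}
    {l : ℝ} (hl : 0 < l) (hgm : Measurable (Function.uncurry g))
    (hg : ∀ w, (∀ i, 0 < w i) → expMoment (roundLaw nS nT D w) (fun R => l * g w R) ≤ 1)
    (r : ℕ) (u : ℝ) :
    runLaw nS nT O α ε D r {h | u < runSum O α ε g h} ≤ ofReal (exp (-(l * u))) := by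
  have hsum : ∀ h : Fin r → RoundData X k nS nT,
      runSum O α ε (fun w R => l * g w R) h = l * runSum O α ε g h := fun h =>
    (Finset.mul_sum _ _ _).symm
  calc runLaw nS nT O α ε D r {h | u < runSum O α ε g h}
      = runLaw nS nT O α ε D r {h | l * u < runSum O α ε (fun w R => l * g w R) h} := by
        simp only [hsum, mul_lt_mul_iff_right₀ hl]
    _ ≤ _ := measure_lt_le_exp_mul_expMoment (measurable_runSum α ε hO (hgm.const_mul l) r) _
    _ ≤ ofReal (exp (-(l * u))) * 1 := by
        gcongr
        exact expMoment_runSum_le_one D hα hε hO hg r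
    _ = _ := mul_one _

lemma lintegral_runSum_le (hO : IsMeasurableRule O)
    {g : (Fin k → ℝ) → RoundData X k nS nT → ENNReal} {p : ENNReal}
    (hg : ∀ w, (∀ i, 0 < w i) → ∫⁻ R, g w R ∂roundLaw nS nT D w ≤ p) (r : ℕ) :
    ∫⁻ h, runSum O α ε g h ∂runLaw nS nT O α ε D r ≤ r * p := by
  induction r with
  | zero => simp [runSum]
  | succ r ih =>
    have hrun := isProbabilityMeasure_runLaw D (nS := nS) (nT := nT) hα hε hO r
    refine (lintegral_runLaw_succ_le D _).trans ?_
    calc _ ≤ ∫⁻ h, (runSum O α ε g h + p) ∂runLaw nS nT O α ε D r := by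
          refine lintegral_mono fun h => ?_
          have hw := weight_pos O hα hε r h
          have hround := isProbabilityMeasure_roundLaw D hw nS nT
          simp only [runSum_snoc]
          rw [lintegral_add_left measurable_const, lintegral_const, measure_univ, mul_one]
          gcongr
          exact hg _ hw
      _ = ∫⁻ h, runSum O α ε g h ∂runLaw nS nT O α ε D r + p := by
          rw [lintegral_add_right _ measurable_const, lintegral_const, measure_univ, mul_one]
      _ ≤ _ := by
          push_cast
          rw [add_mul, one_mul]
          gcongr

lemma runLaw_exists_round_le (hO : IsMeasurableRule O)
    {B : (Fin k → ℝ) → Set (RoundData X k nS nT)}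
    (hB : MeasurableSet {q : (Fin k → ℝ) × RoundData X k nS nT | q.2 ∈ B q.1}) {p : ENNReal}
    (hp : ∀ w, (∀ i, 0 < w i) → roundLaw nS nT D w (B w) ≤ p) (r : ℕ) :
    runLaw nS nT O α ε D r {h | ∃ j, h j ∈ B (weightAt O α ε h j)} ≤ r * p := by
  set g : (Fin k → ℝ) → RoundData X k nS nT → ENNReal := fun w => (B w).indicator 1
  have hg : Measurable (Function.uncurry g) := measurable_one.indicator hB
  calc runLaw nS nT O α ε D r {h | ∃ j, h j ∈ B (weightAt O α ε h j)}
      ≤ runLaw nS nT O α ε D r {h | 1 ≤ runSum O α ε g h} := by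
        refine measure_mono fun h ⟨j, hj⟩ => ?_
        calc 1 = g (weightAt O α ε h j) (h j) := (Set.indicator_of_mem hj 1).symm
          _ ≤ _ := Finset.single_le_sum (f := fun j => g (weightAt O α ε h j) (h j))
            (fun _ _ => zero_le) (Finset.mem_univ j)
    _ ≤ ∫⁻ h, runSum O α ε g h ∂runLaw nS nT O α ε D r := by
        simpa using mul_meas_ge_le_lintegral (measurable_runSum α ε hO hg r) 1
    _ ≤ r * p := lintegral_runSum_le D hα hε hO
        (fun w hw => (lintegral_indicator_one_le _).trans (hp w hw)) r

end Laws

section Scale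

variable {X : Type*} {k nS nT : ℕ} (O : LearningRule X) (α ε : ℝ)

/-- The factor that turns the error of a player into the increment of its weight, before the
truncation at `α'`. -/
noncomputable def scale (S : Fin nS → X × Bool) : ℝ :=
  aPar α ^ 2 / ((1 + 3 * aPar α) * empErr S (O nS S) + 3 * ePar ε)

lemma score_eq (R : RoundData X k nS nT) (i : Fin k) :
    score O α ε R i =
      min (scale O α ε R.1 * (hits (R.2 i) (errSet (O nS R.1)) / nT)) (aPar α) := by
  rw [score, scale, ← empErr_eq, div_mul_eq_mul_div, mul_comm (aPar α ^ 2)]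

variable {α ε}

lemma scale_pos (hα : 0 < α) (hε : 0 < ε) (S : Fin nS → X × Bool) : 0 < scale O α ε S := by
  have := aPar_pos hα
  have := ePar_pos hε
  have := empErr_nonneg S (O nS S)
  unfold scale
  positivity

lemma mul_scale_le (hα : 0 < α) (hε : 0 < ε) {l : ℝ} (hl : 0 ≤ l)
    (hln : l * aPar α ≤ 3 * ePar ε * nT) (S : Fin nS → X × Bool) :
    l * scale O α ε S ≤ aPar α * nT := by
  have ha := aPar_pos hα
  have he := ePar_pos hε
  have hS : 0 ≤ (1 + 3 * aPar α) * empErr S (O nS S) :=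
    mul_nonneg (by positivity) (empErr_nonneg S _)
  calc l * scale O α ε S ≤ l * (aPar α ^ 2 / (3 * ePar ε)) := by
        unfold scale; gcongr; linarith
    _ = aPar α * (l * aPar α) / (3 * ePar ε) := by ring
    _ ≤ aPar α * (3 * ePar ε * nT) / (3 * ePar ε) := by gcongr
    _ = aPar α * nT := by field_simp

end Scale

section Deviations

variable {X : Type*} [MeasurableSpace X] {k nS nT : ℕ} (O : LearningRule X) (α ε : ℝ)
  (D : Fin k → Measure (X × Bool))

/-- The excess of the average increment of a round over `1 + α'` times its natural value, which is
the error on the mixture times the scale. -/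
noncomputable def avgExcess (w : Fin k → ℝ) (R : RoundData X k nS nT) : ℝ :=
  weightedAvg w (score O α ε R) -
    (1 + aPar α) * scale O α ε R.1 * weightedAvg w fun i => err (D i) (O nS R.1)

/-- The shortfall of the increment of player `i` in a round, compared with the truncation at `α'` of
its natural value. -/
noncomputable def shortfall (i : Fin k) (R : RoundData X k nS nT) : ℝ :=
  (1 - 12 / 5 * aPar α) * min (scale O α ε R.1 * err (D i) (O nS R.1)) (aPar α) -
    aPar α ^ 3 - score O α ε R i

/-- The rounds in which the sample from the mixture misleads: the classifier of the round does much
worse on the mixture than on the sample, or `f₀`, whose error is to be at most `θ`, does much worse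
than `θ` on the sample. -/
def badRound (f₀ : X → Bool) (θ : ℝ) (w : Fin k → ℝ) : Set (RoundData X k nS nT) :=
  {R | (1 + aPar α) * empErr R.1 (O nS R.1) + ePar ε < err (mixture w D) (O nS R.1) ∨
    (1 + aPar α) * θ + ePar ε < empErr R.1 f₀}

variable {O}

lemma measurable_scale (hO : IsMeasurableRule O) :
    Measurable fun S : Fin nS → X × Bool => scale O α ε S := by
  have := measurable_empErr (hO nS) measurable_id
  unfold scale
  fun_prop

variable [∀ i, IsProbabilityMeasure (D i)]

lemma measurable_avgExcess (hO : IsMeasurableRule O) :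
    Measurable (Function.uncurry (avgExcess (nS := nS) (nT := nT) O α ε D)) := by
  have hscore := measurable_score (k := k) (nS := nS) (nT := nT) α ε hO
  have hscale := measurable_scale (nS := nS) α ε hO
  have herr : ∀ i, Measurable fun q : (Fin k → ℝ) × RoundData X k nS nT =>
    err (D i) (O nS q.2.1) := fun i => measurable_err (D i) (hO.comp (by fun_prop))
  simp only [Function.uncurry_def, avgExcess, weightedAvg]
  fun_prop

lemma measurable_shortfall (hO : IsMeasurableRule O) (i : Fin k) :
    Measurable (shortfall (nS := nS) (nT := nT) O α ε D i) := by
  have hscore := measurable_score (k := k) (nS := nS) (nT := nT) α ε hO i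
  have hscale := measurable_scale (nS := nS) α ε hO
  have herr : Measurable fun R : RoundData X k nS nT => err (D i) (O nS R.1) :=
    measurable_err (D i) (hO.comp measurable_fst)
  unfold shortfall
  fun_prop

variable {α ε} {w : Fin k → ℝ}

lemma expMoment_roundLaw_le_one [NeZero k] (hw : ∀ i, 0 < w i) {G : RoundData X k nS nT → ℝ}
    (hG : Measurable G)
    (h : ∀ S, expMoment (Measure.pi fun i => Measure.pi fun _ : Fin nT => D i)
      (fun T => G (S, T)) ≤ 1) :
    expMoment (roundLaw nS nT D w) G ≤ 1 := by
  have := isProbabilityMeasure_mixture D hw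
  rw [expMoment, roundLaw, lintegral_prod _ hG.exp.ennreal_ofReal.aemeasurable]
  exact (lintegral_mono h).trans (by simp)

variable {l : ℝ} (hα : 0 < α) (hε : 0 < ε) (ha : aPar α ≤ 1 / 35) (hO : IsMeasurableRule O)
include hα hε ha hO

lemma expMoment_avgExcess_le_one [NeZero k] (hl : 0 ≤ l) (hnT : 0 < nT)
    (hln : l * aPar α ≤ 3 * ePar ε * nT) (hw : ∀ i, 0 < w i) :
    expMoment (roundLaw nS nT D w) (fun R => l * avgExcess O α ε D w R) ≤ 1 := by
  refine expMoment_roundLaw_le_one D hw (((measurable_avgExcess α ε D hO).comp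
    measurable_prodMk_left).const_mul l) fun S => ?_
  have hE := measurableSet_errSet ((hO nS).of_uncurry_left (x := S))
  set E := errSet (O nS S)
  set c := scale O α ε S
  let g : Fin k → (Fin nT → X × Bool) → ℝ := fun i T =>
    l * (min (c * (hits T E / nT)) (aPar α) - (1 + aPar α) * c * (D i).real E)
  have hg : ∀ i, Measurable (g i) := fun i => by fun_prop (disch := exact hE)
  calc _ = expMoment (Measure.pi fun i => Measure.pi fun _ : Fin nT => D i)
        (fun T => weightedAvg w fun i => g i (T i)) := by
        simp only [avgExcess, mul_weightedAvg_sub, score_eq]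
        rfl
    _ ≤ 1 := by
        refine expMoment_sum_mul_le (div_sum_nonneg hw) (sum_div_sum_eq_one hw)
          (fun i => (hg i).comp (measurable_pi_apply i)) fun i => ?_
        rw [expMoment_comp_measurePreserving (measurePreserving_eval _ i) (hg i)]
        exact expMoment_min_hits_sub_le_one (D i) hE (scale_pos O hα hε S).le hl hnT
          (mul_scale_le O hα hε hl hln S) (by linarith)

lemma expMoment_shortfall_le_one [NeZero k] (hl : 1 ≤ l * aPar α ^ 2) (hnT : 0 < nT)
    (hln : l * aPar α ≤ 3 * ePar ε * nT) (hw : ∀ i, 0 < w i) (i : Fin k) :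
    expMoment (roundLaw nS nT D w) (fun R => l * shortfall O α ε D i R) ≤ 1 := by
  refine expMoment_roundLaw_le_one D hw
    ((measurable_shortfall α ε D hO i).const_mul l) fun S => ?_
  have ha0 := aPar_pos hα
  have hl0 : 0 ≤ l := (pos_of_mul_pos_left (zero_lt_one.trans_le hl) (sq_nonneg _)).le
  have hE := measurableSet_errSet ((hO nS).of_uncurry_left (x := S))
  set E := errSet (O nS S)
  set c := scale O α ε S
  let g : (Fin nT → X × Bool) → ℝ := fun T =>
    l * ((1 - 12 / 5 * aPar α) * min (c * (D i).real E) (aPar α) - aPar α ^ 3 -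
      min (c * (hits T E / nT)) (aPar α))
  have hg : Measurable g := by fun_prop (disch := exact hE)
  calc _ = expMoment (Measure.pi fun i => Measure.pi fun _ : Fin nT => D i)
        (fun T => g (T i)) := by
        simp only [shortfall, score_eq]
        rfl
    _ ≤ 1 := by
        rw [expMoment_comp_measurePreserving (measurePreserving_eval _ i) hg]
        exact expMoment_sub_min_hits_le_one (D i) hE ha0 ha (scale_pos O hα hε S).le hl hnT
          (mul_scale_le O hα hε hl0 hln S)

end Deviations

section BadRound

variable {X : Type*} [MeasurableSpace X] {k nS nT : ℕ} {O : LearningRule X} {α ε θ : ℝ}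
  (D : Fin k → Measure (X × Bool)) [∀ i, IsProbabilityMeasure (D i)] {f₀ : X → Bool}
  {w : Fin k → ℝ}

lemma measurable_err_mixture {Y : Type*} [MeasurableSpace Y] {w : Y → Fin k → ℝ}
    (hw : Measurable w) {f : Y → X → Bool} (hf : Measurable (Function.uncurry f)) :
    Measurable fun y => err (mixture (w y) D) (f y) := by
  simp only [err, Measure.real, mixture, Measure.coe_finsetSum, Finset.sum_apply,
    Measure.smul_apply, smul_eq_mul]
  exact (Finset.measurable_sum _ fun i _ => Measurable.mul (by fun_prop)
    (measurable_measure_prodMk_left (measurableSet_mem_errSet hf))).ennreal_toReal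

lemma err_mixture_le [NeZero k] (hθ : ∀ i, err (D i) f₀ ≤ θ) (hw : ∀ i, 0 < w i) :
    err (mixture w D) f₀ ≤ θ := by
  rw [err_mixture D hw]
  exact (weightedAvg_mono hw hθ).trans_eq (weightedAvg_const hw θ)

lemma measurableSet_badRound (hO : IsMeasurableRule O) (hf₀ : Measurable f₀) :
    MeasurableSet {q : (Fin k → ℝ) × RoundData X k nS nT | q.2 ∈ badRound O α ε D f₀ θ q.1} := by
  have hf := hO.comp (by fun_prop : Measurable fun q : (Fin k → ℝ) × RoundData X k nS nT => q.2.1)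
  have hf₀' : Measurable (Function.uncurry fun (_ : (Fin k → ℝ) × RoundData X k nS nT) => f₀) :=
    hf₀.comp measurable_snd
  exact (measurableSet_lt
      (((measurable_empErr hf (by fun_prop)).const_mul _).add_const _)
      (measurable_err_mixture D measurable_fst hf)).union
    (measurableSet_lt measurable_const (measurable_empErr hf₀' (by fun_prop)))

lemma roundLaw_badRound_le [NeZero k] (hα : 0 < α) (hε : 0 < ε) (ha : aPar α ≤ 1)
    (he : ePar ε ≤ 1) (hO : IsMeasurableRule O) {F : Set (X → Bool)} {d : ℕ} (hd : VCDimLE F d)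
    (hOF : ∀ S, O nS S ∈ F) (hf₀ : Measurable f₀) (hθ : ∀ i, err (D i) f₀ ≤ θ) (hnS : 0 < nS)
    {δ : ℝ} (hδ : 0 < δ) (hδ1 : δ ≤ 1)
    (hsize : 10 * (d * log (20 / (aPar α * ePar ε)) + log (1 / δ)) ≤ aPar α * ePar ε * nS)
    (hw : ∀ i, 0 < w i) :
    roundLaw nS nT D w (badRound O α ε D f₀ θ w) ≤ ofReal δ + ofReal δ := by
  have ha0 := aPar_pos hα
  have he0 := ePar_pos hε
  have := isProbabilityMeasure_mixture D hw
  have hsize₀ : log (1 / δ) ≤ aPar α * ePar ε * nS := by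
    have hδ0 : 0 ≤ log (1 / δ) := Real.log_nonneg (one_le_one_div hδ hδ1)
    have hd0 : 0 ≤ d * log (20 / (aPar α * ePar ε)) := by
      refine mul_nonneg d.cast_nonneg (Real.log_nonneg ((one_le_div (by positivity)).2 ?_))
      linarith [mul_le_one₀ ha he0.le he]
    linarith
  calc roundLaw nS nT D w (badRound O α ε D f₀ θ w)
      = (Measure.pi fun _ : Fin nS => mixture w D)
          ({S | (1 + aPar α) * empErr S (O nS S) + ePar ε < err (mixture w D) (O nS S)} ∪
            {S | (1 + aPar α) * θ + ePar ε < empErr S f₀}) := by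
        rw [← mul_one ((Measure.pi fun _ : Fin nS => mixture w D) _), ← measure_univ
          (μ := Measure.pi fun i : Fin k => Measure.pi fun _ : Fin nT => D i),
          ← Measure.prod_prod, Set.prod_univ]
        rfl
    _ ≤ _ := measure_union_le _ _
    _ ≤ ofReal δ + ofReal δ := by
        gcongr
        · exact measure_empErr_lt_err_le _ hd hOF (hO nS) ha0 ha he0 he hδ hnS hsize
        · exact measure_lt_empErr_le _ hf₀ ha0 ha (err_mixture_le D hθ hw) hδ hnS hsize₀

end BadRound

section Regret

lemma one_sub_half_mul_le_log_one_add {a s : ℝ} (hs : 0 ≤ s) (hsa : s ≤ a) :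
    (1 - a / 2) * s ≤ log (1 + s) := by
  refine le_trans ?_ (Real.le_log_one_add_of_nonneg hs)
  rw [le_div_iff₀ (by positivity)]
  nlinarith [mul_nonneg hs (sub_nonneg.2 hsa), mul_nonneg hs (mul_nonneg hs (hs.trans hsa))]

variable {X : Type*} {k nS nT : ℕ} (O : LearningRule X) {α ε : ℝ}

lemma log_sum_weight_le [NeZero k] (hα : 0 < α) (hε : 0 < ε) {r : ℕ}
    (h : Fin r → RoundData X k nS nT) :
    log (∑ i, weight O α ε r h i) ≤
      log k + runSum O α ε (fun w R => weightedAvg w (score O α ε R)) h := by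
  induction r with
  | zero => simp [weight, runSum]
  | succ r ih =>
    have hw := weight_pos O hα hε r fun j => h j.castSucc
    have hΦ : 0 < ∑ i, weight O α ε r (fun j => h j.castSucc) i :=
      Finset.sum_pos (fun i _ => hw i) Finset.univ_nonempty
    have havg := weightedAvg_nonneg hw (score_nonneg O hα hε (h (Fin.last r)))
    have hlog := Real.log_le_sub_one_of_pos (add_pos_of_pos_of_nonneg one_pos havg)
    simp only [weight]
    rw [sum_mul_one_add hw, Real.log_mul hΦ.ne' (by positivity), runSum_succ]
    linarith [ih fun j => h j.castSucc]

lemma mul_runSum_score_le_log_weight (hα : 0 < α) (hε : 0 < ε) {r : ℕ}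
    (h : Fin r → RoundData X k nS nT) (i : Fin k) :
    (1 - aPar α / 2) * runSum O α ε (fun _ R => score O α ε R i) h ≤
      log (weight O α ε r h i) := by
  induction r with
  | zero => simp [weight, runSum]
  | succ r ih =>
    have hs := score_nonneg O hα hε (h (Fin.last r)) i
    have hlog := one_sub_half_mul_le_log_one_add hs (min_le_right _ (aPar α))
    rw [weight, Real.log_mul (weight_pos O hα hε r _ i).ne' (by positivity), runSum_succ]
    linarith [ih fun j => h j.castSucc]

lemma mul_runSum_score_le [NeZero k] (hα : 0 < α) (hε : 0 < ε) {r : ℕ}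
    (h : Fin r → RoundData X k nS nT) (i : Fin k) :
    (1 - aPar α / 2) * runSum O α ε (fun _ R => score O α ε R i) h ≤
      log k + runSum O α ε (fun w R => weightedAvg w (score O α ε R)) h :=
  have hw := weight_pos O hα hε r h
  calc _ ≤ log (weight O α ε r h i) := mul_runSum_score_le_log_weight O hα hε h i
    _ ≤ log (∑ i, weight O α ε r h i) := Real.log_le_log (hw i)
        (Finset.single_le_sum (fun i _ => (hw i).le) (Finset.mem_univ i))
    _ ≤ _ := log_sum_weight_le O hα hε h

end Regret

section GoodRuns

variable {X : Type*} [MeasurableSpace X] {k nS nT t : ℕ} (O : LearningRule X) (α ε : ℝ)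
  (D : Fin k → Measure (X × Bool)) (f₀ : X → Bool) (θ : ℝ)

/-- The event that the samples of a run are representative: no round is bad, and the accumulated
deviations of the increments from their natural values are at most `u`. -/
structure GoodRun (u : ℝ) (h : Fin t → RoundData X k nS nT) : Prop where
  notMem_badRound : ∀ j, h j ∉ badRound O α ε D f₀ θ (weightAt O α ε h j)
  runSum_avgExcess_le : runSum O α ε (avgExcess O α ε D) h ≤ u
  runSum_shortfall_le : ∀ i, runSum O α ε (fun _ => shortfall O α ε D i) h ≤ u

variable {O α ε D f₀ θ} {u : ℝ} {h : Fin t → RoundData X k nS nT}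

lemma one_add_mul_scale_mul_err_mixture_le (hα : 0 < α) (hε : 0 < ε) (ha : aPar α ≤ 1)
    {w : Fin k → ℝ} {R : RoundData X k nS nT} (hR : R ∉ badRound O α ε D f₀ θ w) :
    (1 + aPar α) * scale O α ε R.1 * err (mixture w D) (O nS R.1) ≤ aPar α ^ 2 := by
  have ha0 := aPar_pos hα
  have he0 := ePar_pos hε
  have hx := empErr_nonneg R.1 (O nS R.1)
  have herr : err (mixture w D) (O nS R.1) ≤ (1 + aPar α) * empErr R.1 (O nS R.1) + ePar ε :=
    not_lt.1 fun h => hR (Or.inl h)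
  have key : (1 + aPar α) * err (mixture w D) (O nS R.1) ≤
      (1 + 3 * aPar α) * empErr R.1 (O nS R.1) + 3 * ePar ε := by
    refine (mul_le_mul_of_nonneg_left herr (by positivity)).trans ?_
    nlinarith [mul_nonneg (mul_nonneg ha0.le hx) (sub_nonneg.2 ha)]
  unfold scale
  rw [mul_div_assoc', div_mul_eq_mul_div, div_le_iff₀ (by positivity)]
  linarith [mul_le_mul_of_nonneg_left key (sq_nonneg (aPar α))]

lemma GoodRun.runSum_weightedAvg_score_le [∀ i, IsProbabilityMeasure (D i)]
    (hα : 0 < α) (hε : 0 < ε) (ha : aPar α ≤ 1) (hgood : GoodRun O α ε D f₀ θ u h) :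
    runSum O α ε (fun w R => weightedAvg w (score O α ε R)) h ≤ aPar α ^ 2 * t + u := by
  have hmix : ∀ j, (1 + aPar α) * scale O α ε (h j).1 *
      weightedAvg (weightAt O α ε h j) (fun i => err (D i) (O nS (h j).1)) ≤ aPar α ^ 2 := by
    intro j
    rw [← err_mixture D (w := weightAt O α ε h j) (weight_pos O hα hε _ _)]
    exact one_add_mul_scale_mul_err_mixture_le hα hε ha (hgood.notMem_badRound j)
  have hsum := Finset.sum_le_sum fun j (_ : j ∈ univ) => hmix j
  have hexc := hgood.runSum_avgExcess_le
  simp only [runSum, avgExcess, Finset.sum_sub_distrib] at hexc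
  simp only [Finset.sum_const, Finset.card_univ, Fintype.card_fin, nsmul_eq_mul] at hsum
  unfold runSum
  linarith

lemma GoodRun.mul_sum_min_le_runSum_score (hgood : GoodRun O α ε D f₀ θ u h) (i : Fin k) :
    (1 - 12 / 5 * aPar α) *
        ∑ j, min (scale O α ε (h j).1 * err (D i) (O nS (h j).1)) (aPar α) -
      aPar α ^ 3 * t - u ≤ runSum O α ε (fun _ R => score O α ε R i) h := by
  have hshort := hgood.runSum_shortfall_le i
  simp only [runSum, shortfall, Finset.sum_sub_distrib, ← Finset.mul_sum, Finset.sum_const,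
    Finset.card_univ, Fintype.card_fin, nsmul_eq_mul] at hshort
  unfold runSum
  linarith

lemma le_mul_one_add_of_regret {a M s T : ℝ} (ha0 : 0 ≤ a) (ha : a ≤ 1 / 35) (hM : 0 ≤ M)
    (hT : 0 ≤ T) (hlower : (1 - 12 / 5 * a) * M - 3 / 2 * (a * T) ≤ s)
    (hupper : (1 - a / 2) * s ≤ T * (1 + a)) : M ≤ T * (1 + 7 * a) := by
  have hs := (mul_le_mul_of_nonneg_left hlower (by linarith : 0 ≤ 1 - a / 2)).trans hupper
  have hMT : (1 - 29 / 10 * a) * M ≤ T * (1 + 5 / 2 * a) := by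
    have : 0 ≤ a * a * M := by positivity
    have : 0 ≤ a * a * T := by positivity
    nlinarith
  have hTT : T * (1 + 5 / 2 * a) ≤ (1 - 29 / 10 * a) * (T * (1 + 7 * a)) := by
    have : a * (a * T) ≤ 1 / 35 * (a * T) := by gcongr
    have : 0 ≤ a * T := by positivity
    nlinarith
  exact le_of_mul_le_mul_left (hMT.trans hTT) (by linarith)

lemma GoodRun.sum_min_le [∀ i, IsProbabilityMeasure (D i)] [NeZero k] (hα : 0 < α) (hε : 0 < ε)
    (ha : aPar α ≤ 1 / 35) (hk : log k ≤ aPar α ^ 3 * t / 2)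
    (hgood : GoodRun O α ε D f₀ θ (aPar α ^ 3 * t / 2) h) (i : Fin k) :
    ∑ j, min (scale O α ε (h j).1 * err (D i) (O nS (h j).1)) (aPar α) ≤
      aPar α ^ 2 * t * (1 + 7 * aPar α) := by
  have ha0 := aPar_pos hα
  have hM : 0 ≤ ∑ j, min (scale O α ε (h j).1 * err (D i) (O nS (h j).1)) (aPar α) :=
    Finset.sum_nonneg fun j _ =>
      le_min (mul_nonneg (scale_pos O hα hε _).le measureReal_nonneg) ha0.le
  refine le_mul_one_add_of_regret ha0.le ha hM (by positivity)
    (le_trans (le_of_eq (by ring)) (hgood.mul_sum_min_le_runSum_score i)) ?_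
  linarith [mul_runSum_score_le O hα hε h i,
    hgood.runSum_weightedAvg_score_le hα hε (by linarith)]

end GoodRuns

section Majority

variable {X : Type*} {t : ℕ} {f : Fin t → X → Bool}

lemma le_two_mul_card_of_maj_ne {x : X} {y : Bool} (h : maj f x ≠ y) :
    t ≤ 2 * (univ.filter fun r => f r x ≠ y).card := by
  have hcard := Finset.card_filter_add_card_filter_not (s := univ) fun r => f r x = true
  rw [Finset.card_univ, Fintype.card_fin] at hcard
  cases y <;> simp [maj] at h ⊢ <;> simp at hcard <;> lia

lemma indicator_errSet_maj_le (f : Fin t → X → Bool) (p : X × Bool) :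
    (errSet (maj f)).indicator (fun _ => (t : ℝ)) p ≤
      2 * ∑ r, (errSet (maj f) ∩ errSet (f r)).indicator 1 p := by
  classical
  by_cases hp : p ∈ errSet (maj f)
  · have hcard : ∑ r, (errSet (maj f) ∩ errSet (f r)).indicator (1 : X × Bool → ℝ) p =
        (univ.filter fun r => f r p.1 ≠ p.2).card := by
      simp only [Set.indicator_apply, Set.mem_inter_iff, hp, true_and, Pi.one_apply,
        Finset.sum_boole]
      congr!
    rw [Set.indicator_of_mem hp, hcard]
    exact_mod_cast le_two_mul_card_of_maj_ne hp
  · rw [Set.indicator_of_notMem hp]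
    exact mul_nonneg zero_le_two (Finset.sum_nonneg fun r _ =>
      Set.indicator_nonneg (fun _ _ => zero_le_one) _)

variable [MeasurableSpace X]

lemma measurable_maj (hf : ∀ r, Measurable (f r)) : Measurable (maj f) := by
  have hcount : Measurable fun x => ∑ r, if f r x = true then (1 : ℕ) else 0 :=
    Finset.measurable_sum _ fun r _ =>
      Measurable.ite (hf r (measurableSet_singleton true)) measurable_const measurable_const
  have hpre : maj f ⁻¹' {true} = {x | t < 2 * ∑ r, if f r x = true then (1 : ℕ) else 0} := by
    ext x
    simp [maj]
  refine measurable_to_bool ?_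
  rw [hpre]
  exact measurableSet_lt measurable_const (hcount.const_mul 2)

variable (μ : Measure (X × Bool)) [IsProbabilityMeasure μ]

lemma mul_err_maj_le (hf : ∀ r, Measurable (f r)) :
    t * err μ (maj f) ≤ 2 * ∑ r, min (err μ (f r)) (err μ (maj f)) := by
  have hmaj := measurableSet_errSet (measurable_maj hf)
  have hinter := fun r => hmaj.inter (measurableSet_errSet (hf r))
  have hint : ∀ r, Integrable ((errSet (maj f) ∩ errSet (f r)).indicator (1 : X × Bool → ℝ)) μ :=
    fun r => (integrable_const (1 : ℝ)).indicator (hinter r)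
  have hmono := integral_mono ((integrable_const (t : ℝ)).indicator hmaj)
    ((integrable_finsetSum _ fun r _ => hint r).const_mul 2) (indicator_errSet_maj_le f)
  rw [integral_indicator_const _ hmaj, integral_const_mul,
    integral_finsetSum _ fun r _ => hint r] at hmono
  simp only [integral_indicator_one (hinter _), smul_eq_mul] at hmono
  calc t * err μ (maj f) = μ.real (errSet (maj f)) * t := mul_comm _ _
    _ ≤ 2 * ∑ r, μ.real (errSet (maj f) ∩ errSet (f r)) := hmono
    _ ≤ _ := by
      gcongr with r _
      exact le_min (measureReal_mono Set.inter_subset_right)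
        (measureReal_mono Set.inter_subset_left)

lemma err_maj_le (ht : 0 < t) (hf : ∀ r, Measurable (f r)) {a Q : ℝ} (ha : 0 < a)
    (ha1 : a ≤ 1 / 35) (hQ : 0 < Q)
    (h : ∑ r, min (a ^ 2 / Q * err μ (f r)) a ≤ a ^ 2 * t * (1 + 7 * a)) :
    err μ (maj f) ≤ 2 * (1 + 7 * a) * Q := by
  set P := err μ (maj f)
  set m := max Q (P * a)
  have hQm : Q ≤ m := le_max_left _ _
  have hm : 0 < m := hQ.trans_le hQm
  have hmin : ∀ r, min (err μ (f r)) P ≤ m / a ^ 2 * min (a ^ 2 / Q * err μ (f r)) a := by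
    intro r
    rw [mul_min_of_nonneg _ _ (by positivity)]
    refine min_le_min ?_ ?_
    · calc err μ (f r) = 1 * err μ (f r) := (one_mul _).symm
        _ ≤ m / Q * err μ (f r) := by
          gcongr
          · exact measureReal_nonneg
          · exact (one_le_div hQ).2 hQm
        _ = _ := by field_simp
    · calc P ≤ m / a := (le_div_iff₀ ha).2 (le_max_right _ _)
        _ = _ := by field_simp
  have hP : P ≤ 2 * (1 + 7 * a) * m := by
    refine le_of_mul_le_mul_left ?_ (Nat.cast_pos.2 ht : (0 : ℝ) < t)
    calc t * P ≤ 2 * ∑ r, m / a ^ 2 * min (a ^ 2 / Q * err μ (f r)) a :=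
          (mul_err_maj_le μ hf).trans (by gcongr with r; exact hmin r)
      _ ≤ 2 * (m / a ^ 2 * (a ^ 2 * t * (1 + 7 * a))) := by rw [← Finset.mul_sum]; gcongr
      _ = _ := by field_simp
  rcases max_choice Q (P * a) with hmax | hmax
  · rwa [show m = Q from hmax] at hP
  · have : P ≤ 0 := by
      rw [show m = P * a from hmax] at hP
      have : 0 ≤ P := measureReal_nonneg
      have : 2 * (1 + 7 * a) * a ≤ 1 / 2 := by nlinarith
      nlinarith
    exact this.trans (by positivity)

end Majority

section Opt

variable {X : Type*} {F : Set (X → Bool)} {O : LearningRule X}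

lemma IsERM.empErr_le {τ : ℝ} (hERM : IsERM F τ O) {f : X → Bool} (hf : f ∈ F) {n : ℕ}
    (S : Fin n → X × Bool) : empErr S (O n S) ≤ empErr S f + τ := by
  have hinf : ⨅ g : F, empErr S g.1 ≤ empErr S f :=
    ciInf_le ⟨0, by rintro _ ⟨g, rfl⟩; exact empErr_nonneg S _⟩ (⟨f, hf⟩ : F)
  linarith [(hERM n S).2]

variable [MeasurableSpace X] {k : ℕ} (D : Fin k → Measure (X × Bool))

lemma OPT_nonneg : 0 ≤ OPT F D :=
  Real.iInf_nonneg fun _ => Real.iSup_nonneg fun _ => measureReal_nonneg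

lemma exists_err_le_OPT_add (hF : F.Nonempty) {η : ℝ} (hη : 0 < η) :
    ∃ f ∈ F, ∀ i, err (D i) f ≤ OPT F D + η := by
  have := hF.to_subtype
  obtain ⟨f, hf⟩ := exists_lt_of_ciInf_lt (lt_add_of_pos_right (OPT F D) hη)
  exact ⟨f.1, f.2, fun i => (le_ciSup (Set.finite_range _).bddAbove i).trans hf.le⟩

variable {nS nT : ℕ} {α ε θ : ℝ} {f₀ : X → Bool}

lemma div_le_scale (hα : 0 < α) (hε : 0 < ε) (hERM : IsERM F (ePar ε) O) (hf₀ : f₀ ∈ F)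
    {w : Fin k → ℝ} {R : RoundData X k nS nT} (hR : R ∉ badRound O α ε D f₀ θ w) :
    aPar α ^ 2 / ((1 + 3 * aPar α) * ((1 + aPar α) * θ + 2 * ePar ε) + 3 * ePar ε) ≤
      scale O α ε R.1 := by
  have ha0 := aPar_pos hα
  have he0 := ePar_pos hε
  have hf₀R : empErr R.1 f₀ ≤ (1 + aPar α) * θ + ePar ε := not_lt.1 fun h => hR (Or.inr h)
  have hOR := hERM.empErr_le hf₀ R.1
  have := empErr_nonneg R.1 (O nS R.1)
  unfold scale
  gcongr
  linarith

lemma two_mul_le_two_add_mul_add {a e θ : ℝ} (ha0 : 0 ≤ a) (ha : a ≤ 1 / 35) (he : 0 ≤ e)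
    (hθ : 0 ≤ θ) :
    2 * (1 + 7 * a) * ((1 + 3 * a) * ((1 + a) * (θ + e) + 2 * e) + 3 * e) ≤
      (2 + 35 * a) * θ + 60 * e := by
  have hcube : (1 + 7 * a) * (1 + 3 * a) * (1 + a) ≤ 1 + 35 / 2 * a := by
    have : a * a ≤ a * (1 / 35) := by gcongr
    have : a * (a * a) ≤ a * (1 / 35 * (1 / 35)) := by gcongr
    nlinarith
  have hsq : (1 + 7 * a) * (1 + 3 * a) ≤ 2 := by nlinarith
  have hae : a * e ≤ 1 / 35 * e := by gcongr
  linarith [mul_le_mul_of_nonneg_right hcube hθ, mul_le_mul_of_nonneg_right hcube he,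
    mul_le_mul_of_nonneg_right hsq he]

variable [∀ i, IsProbabilityMeasure (D i)] [NeZero k] {t : ℕ} {h : Fin t → RoundData X k nS nT}

lemma GoodRun.err_output_le (hα : 0 < α) (hε : 0 < ε) (ha : aPar α ≤ 1 / 35) (ht : 0 < t)
    (hk : log k ≤ aPar α ^ 3 * t / 2) (hO : IsMeasurableRule O) (hERM : IsERM F (ePar ε) O)
    (hf₀ : f₀ ∈ F)
    (hgood : GoodRun O α ε D f₀ (OPT F D + ePar ε) (aPar α ^ 3 * t / 2) h) (i : Fin k) :
    err (D i) (output O h) ≤ (2 + α) * OPT F D + ε := by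
  have ha0 := aPar_pos hα
  have he0 := ePar_pos hε
  have hopt := OPT_nonneg (F := F) D
  have hsum := (Finset.sum_le_sum fun j _ => min_le_min_right (aPar α) <|
    mul_le_mul_of_nonneg_right (div_le_scale D hα hε hERM hf₀ (hgood.notMem_badRound j))
      measureReal_nonneg).trans (hgood.sum_min_le hα hε ha hk i)
  calc err (D i) (output O h) ≤ _ :=
        err_maj_le (D i) ht (fun j => (hO nS).of_uncurry_left (x := (h j).1)) ha0 ha
          (by positivity) hsum
    _ ≤ (2 + 35 * aPar α) * OPT F D + 60 * ePar ε :=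
        two_mul_le_two_add_mul_add ha0.le ha he0.le hopt
    _ = (2 + α) * OPT F D + ε := by unfold aPar ePar; ring

end Opt

section Success

variable {X : Type*} [MeasurableSpace X] {k nS nT t d : ℕ} {O : LearningRule X} {α ε δ θ : ℝ}
  {F : Set (X → Bool)} (D : Fin k → Measure (X × Bool)) {f₀ : X → Bool}

lemma setOf_not_goodRun_subset (u : ℝ) :
    {h : Fin t → RoundData X k nS nT | ¬ GoodRun O α ε D f₀ θ u h} ⊆
      {h | ∃ j, h j ∈ badRound O α ε D f₀ θ (weightAt O α ε h j)} ∪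
        ({h | u < runSum O α ε (avgExcess O α ε D) h} ∪
          ⋃ i, {h | u < runSum O α ε (fun _ => shortfall O α ε D i) h}) := by
  intro h hbad
  contrapose! hbad
  simp only [Set.mem_union, Set.mem_ofPred_eq, Set.mem_iUnion, not_or, not_exists, not_lt] at hbad
  exact not_not.2 ⟨hbad.1, hbad.2.1, hbad.2.2⟩

variable [∀ i, IsProbabilityMeasure (D i)] [NeZero k]

lemma runLaw_not_goodRun_le (hα : 0 < α) (hε : 0 < ε) (ha : aPar α ≤ 1 / 35)
    (he : ePar ε ≤ 1) (hO : IsMeasurableRule O) (hd : VCDimLE F d) (hOF : ∀ S, O nS S ∈ F)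
    (hf₀ : Measurable f₀) (hθ : ∀ i, err (D i) f₀ ≤ θ) {δ₁ δ₂ l u : ℝ} (hδ₁ : 0 < δ₁)
    (hδ₁' : δ₁ ≤ 1) (hnS : 0 < nS)
    (hsize : 10 * (d * log (20 / (aPar α * ePar ε)) + log (1 / δ₁)) ≤ aPar α * ePar ε * nS)
    (hl : 1 ≤ l * aPar α ^ 2) (hexp : exp (-(l * u)) ≤ δ₂) (hnT : 0 < nT)
    (hln : l * aPar α ≤ 3 * ePar ε * nT) :
    runLaw nS nT O α ε D t {h | ¬ GoodRun O α ε D f₀ θ u h} ≤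
      ofReal (t * (2 * δ₁) + (k + 1) * δ₂) := by
  have hl0 : 0 < l := pos_of_mul_pos_left (zero_lt_one.trans_le hl) (sq_nonneg _)
  have hδ₂ : 0 ≤ δ₂ := (Real.exp_pos _).le.trans hexp
  have hround : runLaw nS nT O α ε D t {h | ∃ j, h j ∈ badRound O α ε D f₀ θ
      (weightAt O α ε h j)} ≤ t * (ofReal δ₁ + ofReal δ₁) :=
    runLaw_exists_round_le D hα hε hO (measurableSet_badRound D hO hf₀)
      (fun w hw => roundLaw_badRound_le D hα hε (by linarith) he hO hd hOF hf₀ hθ hnS hδ₁ hδ₁'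
        hsize hw) t
  have havg : runLaw nS nT O α ε D t {h | u < runSum O α ε (avgExcess O α ε D) h} ≤ ofReal δ₂ :=
    (runLaw_lt_runSum_le D hα hε hO hl0 (measurable_avgExcess α ε D hO) (fun w hw =>
      expMoment_avgExcess_le_one D hα hε ha hO hl0.le hnT hln hw) t u).trans
      (ENNReal.ofReal_le_ofReal hexp)
  have hshort : ∀ i, runLaw nS nT O α ε D t
      {h | u < runSum O α ε (fun _ => shortfall O α ε D i) h} ≤ ofReal δ₂ := fun i =>
    (runLaw_lt_runSum_le D hα hε hO hl0 (g := fun _ => shortfall O α ε D i)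
      ((measurable_shortfall α ε D hO i).comp measurable_snd)
      (fun w hw => expMoment_shortfall_le_one D hα hε ha hO hl hnT hln hw i) t u).trans
      (ENNReal.ofReal_le_ofReal hexp)
  refine (measure_mono (setOf_not_goodRun_subset D u)).trans ?_
  calc _ ≤ t * (ofReal δ₁ + ofReal δ₁) + (ofReal δ₂ + ∑ _i : Fin k, ofReal δ₂) :=
        (measure_union_le _ _).trans (add_le_add hround ((measure_union_le _ _).trans
          (add_le_add havg ((measure_iUnion_fintype_le _ _).trans
            (Finset.sum_le_sum fun i _ => hshort i)))))
    _ = ofReal (t * (2 * δ₁) + (k + 1) * δ₂) := by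
        rw [ENNReal.ofReal_add (by positivity) (by positivity), ENNReal.ofReal_mul (p := t)
          (by positivity), two_mul, ENNReal.ofReal_add hδ₁.le hδ₁.le, ENNReal.ofReal_mul
          (p := k + 1) (by positivity), ENNReal.ofReal_add (by positivity) zero_le_one]
        simp [add_mul, add_comm]

lemma ofReal_one_sub_le_of_compl_subset {Ω : Type*} [MeasurableSpace Ω] (μ : Measure Ω)
    [IsProbabilityMeasure μ] {s t : Set Ω} (hst : sᶜ ⊆ t) {δ : ℝ} (hδ : 0 ≤ δ)
    (ht : μ t ≤ ofReal δ) : ofReal (1 - δ) ≤ μ s := by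
  rw [ENNReal.ofReal_sub _ hδ, ENNReal.ofReal_one, tsub_le_iff_right, ← measure_univ (μ := μ),
    ← Set.union_compl_self s]
  exact (measure_union_le _ _).trans (add_le_add_right ((measure_mono hst).trans ht) _)

lemma ofReal_le_runLaw_err_output_le (hα : 0 < α) (hε : 0 < ε) (ha : aPar α ≤ 1 / 35)
    (he : ePar ε ≤ 1) (hF : ∀ f ∈ F, Measurable f) (hd : VCDimLE F d) (hne : F.Nonempty)
    (hO : IsMeasurableRule O) (hERM : IsERM F (ePar ε) O) (ht : 0 < t)
    (hk : log k ≤ aPar α ^ 3 * t / 2) {δ₁ l : ℝ} (hδ₁ : 0 < δ₁) (hδ₁' : δ₁ ≤ 1)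
    (htδ : 4 * t * δ₁ ≤ δ) (hnS : 0 < nS)
    (hsize : 10 * (d * log (20 / (aPar α * ePar ε)) + log (1 / δ₁)) ≤ aPar α * ePar ε * nS)
    (hl : 1 ≤ l * aPar α ^ 2) (hexp : exp (-(l * (aPar α ^ 3 * t / 2))) ≤ δ / (4 * k))
    (hnT : 0 < nT) (hln : l * aPar α ≤ 3 * ePar ε * nT) :
    ofReal (1 - δ) ≤ runLaw nS nT O α ε D t
      {h | ∀ i, err (D i) (output O h) ≤ (2 + α) * OPT F D + ε} := by
  obtain ⟨f₀, hf₀, hf₀err⟩ := exists_err_le_OPT_add D hne (ePar_pos hε)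
  have := isProbabilityMeasure_runLaw D (nS := nS) (nT := nT) hα hε hO t
  have hδ : 0 ≤ δ := le_trans (by positivity) htδ
  refine ofReal_one_sub_le_of_compl_subset _ (fun h hbad hgood => hbad fun i =>
    GoodRun.err_output_le D hα hε ha ht hk hO hERM hf₀ hgood i) hδ
    ((runLaw_not_goodRun_le D hα hε ha he hO hd (fun S => (hERM nS S).1) (hF f₀ hf₀) hf₀err
      hδ₁ hδ₁' hnS hsize hl hexp hnT hln).trans (ENNReal.ofReal_le_ofReal ?_))
  have hk1 : (1 : ℝ) ≤ k := Nat.one_le_cast.2 (NeZero.pos k)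
  have hplayers : (k + 1) * (δ / (4 * k)) ≤ δ / 2 := by
    rw [mul_div_assoc', div_le_div_iff₀ (by positivity) two_pos]
    nlinarith
  linarith

end Success

section VCDimZero

variable {X : Type*} {F : Set (X → Bool)}

lemma VCDimLE.subsingleton (hd : VCDimLE F 0) : F.Subsingleton := by
  intro f hf g hg
  by_contra hne
  obtain ⟨x, hx⟩ := Function.ne_iff.1 hne
  have hshatters : Shatters F {x} := by
    intro b
    by_cases hb : f x = b x
    · exact ⟨f, hf, by simpa using hb⟩
    · exact ⟨g, hg, by simpa using (by cases hfx : f x <;> simp_all : g x = b x)⟩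
  simpa using hd _ hshatters

lemma maj_const {t : ℕ} (ht : 0 < t) (f : X → Bool) : maj (fun _ : Fin t => f) = f := by
  funext x
  cases hx : f x <;> simp [maj, hx]
  lia

variable [MeasurableSpace X] {k nS nT t : ℕ} {O : LearningRule X} {α ε δ : ℝ}
  (D : Fin k → Measure (X × Bool)) [∀ i, IsProbabilityMeasure (D i)] [NeZero k]

lemma ofReal_le_runLaw_err_output_le_of_vcDimLE_zero (hα : 0 < α) (hε : 0 < ε)
    (hd : VCDimLE F 0) (hne : F.Nonempty) (hO : IsMeasurableRule O)
    (hERM : IsERM F (ePar ε) O) (ht : 0 < t) (hδ : 0 ≤ δ) :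
    ofReal (1 - δ) ≤ runLaw nS nT O α ε D t
      {h | ∀ i, err (D i) (output O h) ≤ (2 + α) * OPT F D + ε} := by
  have := isProbabilityMeasure_runLaw D (nS := nS) (nT := nT) hα hε hO t
  obtain ⟨f, hf, hferr⟩ := exists_err_le_OPT_add D hne hε
  refine ofReal_one_sub_le_of_compl_subset _ (t := ∅) (fun h hbad => hbad fun i => ?_) hδ (by simp)
  have houtput : output O h = f := by
    rw [output, ← maj_const ht f]
    exact congrArg maj (funext fun r => hd.subsingleton (hERM nS _).1 hf)
  rw [houtput]
  nlinarith [hferr i, OPT_nonneg (F := F) D]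

end VCDimZero

section Parameters

/-- The ranges of the parameters for which the algorithm is run: the number of players `k`, the
additive accuracy `ε`, the confidence `δ` and the multiplicative slack `α`. -/
structure Admissible (k : ℕ) (ε δ α : ℝ) : Prop where
  two_le : 2 ≤ k
  ε_pos : 0 < ε
  δ_pos : 0 < δ
  δ_lt_one : δ < 1
  lt_α : 7 * ε / 6 < α
  α_lt_one : α < 1

/-- The order of the number of examples that a round draws from its mixture: the sample complexity
of relative deviations for a class of VC dimension `d`. -/
noncomputable def mixtureSampleBound (d k : ℕ) (ε δ α : ℝ) : ℝ :=
  1 / (aPar α * ePar ε) * (d * log (1 / ePar ε) + log (1 / dPar k α δ))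

/-- The order of the number of examples that a round draws from each player. -/
noncomputable def playerSampleBound (k : ℕ) (ε δ α : ℝ) : ℝ :=
  1 / (aPar α * ePar ε) * log (k / δ)

/-- The order of the number of examples that the whole run draws. -/
noncomputable def totalSampleBound (d k : ℕ) (ε δ α : ℝ) : ℝ :=
  log k / (α ^ 4 * ε) * (d * log (1 / ε) + k * log (k / δ))

/-- The size `n_S` of the samples from the mixtures. -/
noncomputable def mixtureSampleSize (d k : ℕ) (ε δ α : ℝ) : ℕ :=
  ⌈30 * mixtureSampleBound d k ε δ α⌉₊

/-- The size `n_T` of the samples from the single players. -/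
noncomputable def playerSampleSize (k : ℕ) (ε δ α : ℝ) : ℕ :=
  ⌈playerSampleBound k ε δ α⌉₊

variable {d k : ℕ} {ε δ α : ℝ}

lemma two_mul_log_div_le_rounds (k : ℕ) (α : ℝ) :
    2 * (log k / aPar α ^ 3) ≤ rounds k α := by
  unfold rounds
  push_cast
  gcongr
  exact Nat.le_ceil _

namespace Admissible

variable (hp : Admissible k ε δ α)
include hp

lemma neZero : NeZero k := ⟨by have := hp.two_le; lia⟩

lemma two_le_cast : (2 : ℝ) ≤ k := by exact_mod_cast hp.two_le

lemma ε_le : ε ≤ 6 / 7 := by linarith [hp.lt_α, hp.α_lt_one]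

lemma α_pos : 0 < α := by linarith [hp.ε_pos, hp.lt_α]

lemma aPar_pos : 0 < aPar α := CollabPAC.aPar_pos hp.α_pos

lemma ePar_pos : 0 < ePar ε := CollabPAC.ePar_pos hp.ε_pos

lemma aPar_le : aPar α ≤ 1 / 35 := by unfold aPar; linarith [hp.α_lt_one]

lemma ePar_le : ePar ε ≤ 1 / 60 := by unfold ePar; linarith [hp.ε_le]

lemma ePar_le_half_aPar : ePar ε ≤ aPar α / 2 := by
  unfold ePar aPar
  linarith [hp.α_pos, hp.lt_α]

lemma le_log : 69 / 100 ≤ log k := by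
  linarith [Real.log_two_gt_d9, Real.log_le_log two_pos hp.two_le_cast]

lemma log_le_log_div : log k ≤ log (k / δ) := by
  have hk := hp.two_le_cast
  exact Real.log_le_log (by linarith)
    (le_div_self (by linarith) hp.δ_pos hp.δ_lt_one.le)

lemma le_log_div_aPar_cube : 9999 ≤ log k / aPar α ^ 3 := by
  have ha0 := hp.aPar_pos
  have ha : aPar α ^ 3 ≤ (1 / 35) ^ 3 := pow_le_pow_left₀ ha0.le hp.aPar_le 3
  rw [le_div_iff₀ (by positivity)]
  linarith [hp.le_log]

lemma le_rounds : (9999 : ℝ) ≤ rounds k α := by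
  linarith [hp.le_log_div_aPar_cube, two_mul_log_div_le_rounds k α]

lemma rounds_pos : 0 < rounds k α := by
  exact_mod_cast (show (0 : ℝ) < 9999 by norm_num).trans_le hp.le_rounds

lemma rounds_le : (rounds k α : ℝ) ≤ 4 * (log k / aPar α ^ 3) := by
  have hlog := hp.le_log_div_aPar_cube
  have hceil := Nat.ceil_lt_add_one (show 0 ≤ log k / aPar α ^ 3 by linarith)
  unfold rounds
  push_cast
  linarith

lemma log_le_aPar_cube_mul_rounds : log k ≤ aPar α ^ 3 * rounds k α / 2 := by
  have ha0 := hp.aPar_pos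
  calc log k = aPar α ^ 3 * (2 * (log k / aPar α ^ 3)) / 2 := by field_simp
    _ ≤ aPar α ^ 3 * rounds k α / 2 := by gcongr; exact two_mul_log_div_le_rounds k α

lemma dPar_pos : 0 < dPar k α δ :=
  div_pos hp.δ_pos (mul_pos four_pos (Nat.cast_pos.2 hp.rounds_pos))

lemma dPar_le : dPar k α δ ≤ δ / 9999 :=
  div_le_div_of_nonneg_left hp.δ_pos.le (by norm_num) (by linarith [hp.le_rounds])

lemma one_le_log_one_div_dPar : 1 ≤ log (1 / dPar k α δ) := by
  have hpos := hp.dPar_pos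
  have hsmall : dPar k α δ ≤ 1 / 9999 := by linarith [hp.dPar_le, hp.δ_lt_one]
  rw [Real.le_log_iff_exp_le (by positivity), le_div_iff₀ hpos]
  nlinarith [Real.exp_one_lt_d9]

lemma log_one_div_dPar_le : log (1 / dPar k α δ) ≤ log (k / δ) + 4 * log (1 / ePar ε) := by
  have hδ := hp.δ_pos
  have he0 := hp.ePar_pos
  have hd0 := hp.dPar_pos
  have hk0 : (0 : ℝ) < k := by linarith [hp.two_le_cast]
  have ht : (rounds k α : ℝ) ≤ 4 * (k / ePar ε ^ 3) := by
    refine hp.rounds_le.trans ?_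
    gcongr
    · exact (Real.log_le_sub_one_of_pos hk0).trans (by linarith)
    · linarith [hp.ePar_le_half_aPar, hp.aPar_pos]
  have hinv : 16 ≤ 1 / ePar ε := by
    rw [le_div_iff₀ he0]
    linarith [hp.ePar_le]
  have hdPar : 1 / dPar k α δ ≤ k / δ * (1 / ePar ε) ^ 4 :=
    calc 1 / dPar k α δ = 4 * rounds k α / δ := one_div_div _ _
      _ ≤ 4 * (4 * (k / ePar ε ^ 3)) / δ := by gcongr
      _ = k / δ * (16 * (1 / ePar ε) ^ 3) := by field_simp; norm_num
      _ ≤ k / δ * (1 / ePar ε * (1 / ePar ε) ^ 3) := by gcongr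
      _ = k / δ * (1 / ePar ε) ^ 4 := by ring
  calc log (1 / dPar k α δ) ≤ log (k / δ * (1 / ePar ε) ^ 4) :=
        Real.log_le_log (by positivity) hdPar
    _ = log (k / δ) + 4 * log (1 / ePar ε) := by
        rw [Real.log_mul (by positivity) (by positivity), Real.log_pow]
        norm_num

lemma log_one_div_ε_nonneg : 0 ≤ log (1 / ε) :=
  Real.log_nonneg (one_le_one_div hp.ε_pos (by linarith [hp.ε_le]))

lemma log_one_div_ePar_nonneg : 0 ≤ log (1 / ePar ε) :=
  Real.log_nonneg (one_le_one_div hp.ePar_pos (by linarith [hp.ePar_le]))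

-- `log (60 / ε) ≤ 59 + log (1 / ε)`, where `log (1 / ε) ≥ 1 - ε ≥ 1 / 7` absorbs the constant.
lemma log_one_div_ePar_le : log (1 / ePar ε) ≤ 414 * log (1 / ε) := by
  have hε := hp.ε_pos
  have hlog : 1 / 7 ≤ log (1 / ε) := by
    have := Real.one_sub_inv_le_log_of_pos (one_div_pos.2 hε)
    rw [one_div, inv_inv, ← one_div] at this
    linarith [hp.ε_le]
  have hePar : 1 / ePar ε = 60 * (1 / ε) := by unfold ePar; field_simp
  rw [hePar, Real.log_mul (by norm_num) (by positivity)]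
  linarith [Real.log_le_sub_one_of_pos (show (0 : ℝ) < 60 by norm_num)]

lemma one_le_one_div_mul : 1 ≤ 1 / (aPar α * ePar ε) :=
  one_le_one_div (mul_pos hp.aPar_pos hp.ePar_pos) <|
    mul_le_one₀ (by linarith [hp.aPar_le]) hp.ePar_pos.le (by linarith [hp.ePar_le])

lemma one_le_mixtureSampleBound (d : ℕ) : 1 ≤ mixtureSampleBound d k ε δ α :=
  one_le_mul_of_one_le_of_one_le hp.one_le_one_div_mul <| by
    linarith [hp.one_le_log_one_div_dPar,
      mul_nonneg (Nat.cast_nonneg (α := ℝ) d) hp.log_one_div_ePar_nonneg]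

lemma le_playerSampleBound : 69 / 100 ≤ playerSampleBound k ε δ α := by
  have hlog := hp.le_log.trans hp.log_le_log_div
  exact hlog.trans (le_mul_of_one_le_left (by linarith) hp.one_le_one_div_mul)

lemma playerSampleBound_le_dPar :
    playerSampleBound k ε δ α ≤ playerSampleBound k ε (dPar k α δ) α := by
  have ha0 := hp.aPar_pos
  have he0 := hp.ePar_pos
  have hd0 := hp.dPar_pos
  have hδ := hp.δ_pos
  have hk := hp.two_le_cast
  unfold playerSampleBound
  gcongr
  linarith [hp.dPar_le]

lemma totalSampleBound_nonneg (d : ℕ) : 0 ≤ totalSampleBound d k ε δ α := by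
  have hα := hp.α_pos
  have hε := hp.ε_pos
  have hlog := hp.le_log
  have hlogε := hp.log_one_div_ε_nonneg
  have hlogδ := hp.log_le_log_div
  unfold totalSampleBound
  exact mul_nonneg (div_nonneg (by linarith) (by positivity)) (add_nonneg (by positivity)
    (mul_nonneg (Nat.cast_nonneg k) (by linarith)))

lemma mixtureSampleSize_pos (d : ℕ) : 0 < mixtureSampleSize d k ε δ α :=
  Nat.ceil_pos.2 (by linarith [hp.one_le_mixtureSampleBound d])

lemma playerSampleSize_pos : 0 < playerSampleSize k ε δ α :=
  Nat.ceil_pos.2 (by linarith [hp.le_playerSampleBound])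

lemma mixtureSampleSize_le (d : ℕ) :
    (mixtureSampleSize d k ε δ α : ℝ) ≤ 31 * mixtureSampleBound d k ε δ α := by
  have hone := hp.one_le_mixtureSampleBound d
  have := Nat.ceil_lt_add_one (show 0 ≤ 30 * mixtureSampleBound d k ε δ α by linarith)
  unfold mixtureSampleSize
  linarith

lemma playerSampleSize_le : (playerSampleSize k ε δ α : ℝ) ≤ 3 * playerSampleBound k ε δ α := by
  have hpos := hp.le_playerSampleBound
  have := Nat.ceil_lt_add_one (show 0 ≤ playerSampleBound k ε δ α by linarith)
  unfold playerSampleSize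
  linarith

lemma roundSampleBound_le (hd : 1 ≤ d) :
    31 * mixtureSampleBound d k ε δ α + k * (3 * playerSampleBound k ε δ α) ≤
      1 / (aPar α * ePar ε) * (64170 * (d * log (1 / ε) + k * log (k / δ))) := by
  have hlogδ := hp.le_log.trans hp.log_le_log_div
  have hePar : (d : ℝ) * log (1 / ePar ε) ≤ d * (414 * log (1 / ε)) :=
    mul_le_mul_of_nonneg_left hp.log_one_div_ePar_le (Nat.cast_nonneg d)
  have hd' : log (1 / ePar ε) ≤ d * log (1 / ePar ε) :=
    le_mul_of_one_le_left hp.log_one_div_ePar_nonneg (Nat.one_le_cast.2 hd)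
  have hk' : log (k / δ) ≤ k * log (k / δ) :=
    le_mul_of_one_le_left (by linarith) (by linarith [hp.two_le_cast])
  calc _ = 1 / (aPar α * ePar ε) * (31 * (d * log (1 / ePar ε) + log (1 / dPar k α δ)) +
        3 * (k * log (k / δ))) := by unfold mixtureSampleBound playerSampleBound; ring
    _ ≤ _ := by
        refine mul_le_mul_of_nonneg_left ?_ (by linarith [hp.one_le_one_div_mul])
        linarith [hp.log_one_div_dPar_le]

lemma sampleCount_le (hd : 1 ≤ d) :
    (sampleCount k (mixtureSampleSize d k ε δ α) (playerSampleSize k ε δ α) α : ℝ) ≤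
      10 ^ 14 * totalSampleBound d k ε δ α := by
  have hα := hp.α_pos
  have ha0 := hp.aPar_pos
  have : 0 ≤ log k := by linarith [hp.le_log]
  calc (sampleCount k (mixtureSampleSize d k ε δ α) (playerSampleSize k ε δ α) α : ℝ)
      = rounds k α * (mixtureSampleSize d k ε δ α + k * playerSampleSize k ε δ α) := by
        simp only [sampleCount, Nat.cast_mul, Nat.cast_add]
    _ ≤ 4 * (log k / aPar α ^ 3) *
        (31 * mixtureSampleBound d k ε δ α + k * (3 * playerSampleBound k ε δ α)) := by
        gcongr
        exacts [hp.rounds_le, hp.mixtureSampleSize_le d, hp.playerSampleSize_le]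
    _ ≤ 4 * (log k / aPar α ^ 3) *
        (1 / (aPar α * ePar ε) * (64170 * (d * log (1 / ε) + k * log (k / δ)))) := by
        gcongr
        exact hp.roundSampleBound_le hd
    _ = 4 * 64170 * 35 ^ 4 * 60 * totalSampleBound d k ε δ α := by
        unfold totalSampleBound aPar ePar
        field_simp
    _ ≤ 10 ^ 14 * totalSampleBound d k ε δ α :=
        mul_le_mul_of_nonneg_right (by norm_num) (hp.totalSampleBound_nonneg d)

lemma log_div_mul_le : log (20 / (aPar α * ePar ε)) ≤ 3 * log (1 / ePar ε) := by
  have ha0 := hp.aPar_pos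
  have he0 := hp.ePar_pos
  have hquad : 20 * ePar ε ^ 2 ≤ aPar α := by nlinarith [hp.ePar_le, hp.ePar_le_half_aPar]
  calc log (20 / (aPar α * ePar ε)) ≤ log ((1 / ePar ε) ^ 3) := by
        refine Real.log_le_log (by positivity) ?_
        rw [one_div_pow, div_le_div_iff₀ (by positivity) (by positivity)]
        linarith [mul_le_mul_of_nonneg_right hquad he0.le]
    _ = 3 * log (1 / ePar ε) := by rw [Real.log_pow]; norm_num

lemma le_mul_mixtureSampleSize (d : ℕ) :
    10 * (d * log (20 / (aPar α * ePar ε)) + log (1 / dPar k α δ)) ≤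
      aPar α * ePar ε * mixtureSampleSize d k ε δ α := by
  have ha0 := hp.aPar_pos
  have he0 := hp.ePar_pos
  have hlog := mul_le_mul_of_nonneg_left hp.log_div_mul_le (Nat.cast_nonneg (α := ℝ) d)
  calc 10 * (d * log (20 / (aPar α * ePar ε)) + log (1 / dPar k α δ))
      ≤ 30 * (d * log (1 / ePar ε) + log (1 / dPar k α δ)) := by
        linarith [hp.one_le_log_one_div_dPar]
    _ = aPar α * ePar ε * (30 * mixtureSampleBound d k ε δ α) := by
        unfold mixtureSampleBound; field_simp
    _ ≤ aPar α * ePar ε * mixtureSampleSize d k ε δ α := by gcongr; exact Nat.le_ceil _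

lemma rate_mul_aPar_le :
    2 * log (k / δ) / aPar α ^ 2 * aPar α ≤ 3 * ePar ε * playerSampleSize k ε δ α := by
  have ha0 := hp.aPar_pos
  have he0 := hp.ePar_pos
  have hlog : 0 ≤ log (k / δ) := by linarith [hp.le_log, hp.log_le_log_div]
  calc 2 * log (k / δ) / aPar α ^ 2 * aPar α = 2 * (log (k / δ) / aPar α) := by field_simp
    _ ≤ 3 * (log (k / δ) / aPar α) := by gcongr; norm_num
    _ = 3 * ePar ε * playerSampleBound k ε δ α := by unfold playerSampleBound; field_simp
    _ ≤ 3 * ePar ε * playerSampleSize k ε δ α := by gcongr; exact Nat.le_ceil _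

lemma three_le_aPar_mul_rounds : 3 ≤ aPar α * rounds k α := by
  have ha0 := hp.aPar_pos
  have ha : aPar α ^ 2 ≤ (1 / 35) ^ 2 := pow_le_pow_left₀ ha0.le hp.aPar_le 2
  calc (3 : ℝ) ≤ 2 * (log k / aPar α ^ 2) := by
        rw [mul_div_assoc', le_div_iff₀ (by positivity)]
        linarith [hp.le_log]
    _ = aPar α * (2 * (log k / aPar α ^ 3)) := by field_simp
    _ ≤ aPar α * rounds k α := by gcongr; exact two_mul_log_div_le_rounds k α

lemma exp_neg_rate_le :
    exp (-(2 * log (k / δ) / aPar α ^ 2 * (aPar α ^ 3 * rounds k α / 2))) ≤ δ / (4 * k) := by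
  have ha0 := hp.aPar_pos
  have hδ := hp.δ_pos
  have hk := hp.two_le_cast
  have hlog : 0 ≤ log (k / δ) := by linarith [hp.le_log, hp.log_le_log_div]
  have htwo : log 2 ≤ log (k / δ) :=
    (Real.log_le_log two_pos hk).trans hp.log_le_log_div
  have hfour : log 4 = 2 * log 2 := by
    rw [show (4 : ℝ) = 2 ^ 2 by norm_num, Real.log_pow, Nat.cast_two]
  have hrhs : log (δ / (4 * k)) = -(log 4 + log (k / δ)) := by
    rw [← Real.log_mul (by norm_num) (by positivity), ← Real.log_inv]
    congr 1
    field_simp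
  have hrate : 2 * log (k / δ) / aPar α ^ 2 * (aPar α ^ 3 * rounds k α / 2) =
      log (k / δ) * (aPar α * rounds k α) := by field_simp
  rw [← Real.le_log_iff_exp_le (by positivity), hrhs, hrate, neg_le_neg_iff]
  linarith [mul_le_mul_of_nonneg_left hp.three_le_aPar_mul_rounds hlog]

variable {X : Type*} [MeasurableSpace X] {F : Set (X → Bool)} {O : LearningRule X}
  {D : Fin k → Measure (X × Bool)} [∀ i, IsProbabilityMeasure (D i)]

lemma ofReal_le_runLaw_err_output_le (hF : ∀ f ∈ F, Measurable f) (hd : VCDimLE F d)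
    (hO : IsMeasurableRule O) (hERM : IsERM F (ePar ε) O) :
    ofReal (1 - δ) ≤
      runLaw (mixtureSampleSize d k ε δ α) (playerSampleSize k ε δ α) O α ε D (rounds k α)
        {h | ∀ i, err (D i) (output O h) ≤ (2 + α) * OPT F D + ε} := by
  have := hp.neZero
  have ha0 := hp.aPar_pos
  have ht : (0 : ℝ) < rounds k α := Nat.cast_pos.2 hp.rounds_pos
  have hδ₁ : dPar k α δ ≤ 1 := by linarith [hp.dPar_le, hp.δ_lt_one]
  have htδ : 4 * rounds k α * dPar k α δ = δ := by unfold dPar; field_simp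
  have hrate : 1 ≤ 2 * log (k / δ) / aPar α ^ 2 * aPar α ^ 2 := by
    rw [div_mul_cancel₀ _ (by positivity)]
    linarith [hp.le_log, hp.log_le_log_div]
  exact CollabPAC.ofReal_le_runLaw_err_output_le D hp.α_pos hp.ε_pos hp.aPar_le
    (by linarith [hp.ePar_le]) hF hd ⟨_, (hERM 0 Fin.elim0).1⟩ hO hERM hp.rounds_pos
    hp.log_le_aPar_cube_mul_rounds hp.dPar_pos hδ₁ htδ.le (hp.mixtureSampleSize_pos d)
    (hp.le_mul_mixtureSampleSize d) hrate hp.exp_neg_rate_le hp.playerSampleSize_pos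
    hp.rate_mul_aPar_le

lemma ofReal_le_runLaw_err_output_le_of_vcDimLE_zero (nS nT : ℕ) (hd : VCDimLE F 0)
    (hO : IsMeasurableRule O) (hERM : IsERM F (ePar ε) O) :
    ofReal (1 - δ) ≤ runLaw nS nT O α ε D (rounds k α)
      {h | ∀ i, err (D i) (output O h) ≤ (2 + α) * OPT F D + ε} :=
  have := hp.neZero
  CollabPAC.ofReal_le_runLaw_err_output_le_of_vcDimLE_zero D hp.α_pos hp.ε_pos hd
    ⟨_, (hERM 0 Fin.elim0).1⟩ hO hERM hp.rounds_pos hp.δ_pos.le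

end Admissible

end Parameters

end CollabPAC

theorem theorem3 :
    ∃ C : ℝ, 0 < C ∧
      ∀ (d k : ℕ) (ε δ α : ℝ), 2 ≤ k → 0 < ε → ε < 1 → 0 < δ → δ < 1 → 7 * ε / 6 < α → α < 1 →
        ∃ nS nT : ℕ,
          (nS : ℝ) ≤ C * (1 / (CollabPAC.aPar α * CollabPAC.ePar ε) *
            (d * Real.log (1 / CollabPAC.ePar ε) + Real.log (1 / CollabPAC.dPar k α δ))) ∧
          (nT : ℝ) ≤ C * (1 / (CollabPAC.aPar α * CollabPAC.ePar ε) *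
            Real.log (k / CollabPAC.dPar k α δ)) ∧
          (CollabPAC.sampleCount k nS nT α : ℝ) ≤ C * (Real.log k / (α ^ 4 * ε) *
            (d * Real.log (1 / ε) + k * Real.log (k / δ))) ∧
          ∀ (X : Type*) [MeasurableSpace X] (F : Set (X → Bool)) (O : CollabPAC.LearningRule X)
            (D : Fin k → Measure (X × Bool)),
            (∀ f ∈ F, Measurable f) → CollabPAC.HasVCDim F d →
            CollabPAC.IsMeasurableRule O → CollabPAC.IsERM F (CollabPAC.ePar ε) O →
            (∀ i, IsProbabilityMeasure (D i)) →
            ENNReal.ofReal (1 - δ) ≤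
              CollabPAC.runLaw nS nT O α ε D (CollabPAC.rounds k α)
                {h | ∀ i, CollabPAC.err (D i) (CollabPAC.output O h) ≤
                  (2 + α) * CollabPAC.OPT F D + ε} := by
  open CollabPAC in
  refine ⟨10 ^ 14, by norm_num, fun d k ε δ α hk hε _ hδ hδ1 hεα hα1 => ?_⟩
  have hp : Admissible k ε δ α := ⟨hk, hε, hδ, hδ1, hεα, hα1⟩
  have hmix := hp.one_le_mixtureSampleBound d
  have hplayer := hp.le_playerSampleBound
  have hdPar := hp.playerSampleBound_le_dPar
  have htotal := hp.totalSampleBound_nonneg d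
  simp only [mixtureSampleBound, playerSampleBound, totalSampleBound] at hmix hplayer hdPar htotal
  rcases d.eq_zero_or_pos with rfl | hd
  · refine ⟨0, 0, ?_, ?_, ?_, fun X _ F O D _ hVC hO hERM _ =>
      hp.ofReal_le_runLaw_err_output_le_of_vcDimLE_zero 0 0 hVC.2 hO hERM⟩
    · rw [Nat.cast_zero]; linarith
    · rw [Nat.cast_zero]; linarith
    · simp only [sampleCount, mul_zero, add_zero, Nat.cast_zero]; linarith
  · refine ⟨mixtureSampleSize d k ε δ α, playerSampleSize k ε δ α,
      (hp.mixtureSampleSize_le d).trans ?_, hp.playerSampleSize_le.trans ?_,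
      hp.sampleCount_le hd, fun X _ F O D hF hVC hO hERM _ =>
      hp.ofReal_le_runLaw_err_output_le hF hVC.2 hO hERM⟩
    · unfold mixtureSampleBound; linarith
    · unfold playerSampleBound; linarith
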